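/- **Setting.** A joint distribution of $N$ real-valued time series $\mathbf x_i=(X^i_1,X^i_2,\dots)$, $i=1,\dots,N$, is a probability measure $\rho$ on $(\mathbb R^N)^{\mathbb N}$. It is *stationary ergodic* if it is shift-invariant and for every $m$ and every measurable $S\subseteq(\mathbb R^N)^m$ the fraction of those among the $n-m+1$ blocks of length $m$ in the first $n$ observations that lie in $S$ converges $\rho$-a.s., as $n\to\infty$, to the probability that the first block lies in $S$. A partition $\{U_1,\dots,U_k\}$ of $\{1,\dots,N\}$ into non-empty clusters is the *ground-truth clustering* if the joint processes $(\mathbf x_i)_{i\in U_1},\dots,(\mathbf x_i)_{i\in U_k}$ are mutually independent and no proper refinement has this property. **Empirical sum-information.** For each $m,l$ fix a partition $B^{m,l}$ of $\mathbb R^m$ into $2^l$ Borel cells (some may be empty) such that $B^{m,l+1}$ refines $B^{m,l}$ and, for each $m$, $\bigcup_l B^{m,l}$ generates the Borel $\sigma$-algebra of $\mathbb R^m$. For a group $A$ of series let $[X^A_{1..m}]^l$ be the tuple, over $i\in A$, of the indices of the cells of $B^{m,l}$ that contain $X^i_{1..m}$. Let $\hat h_n$ denote the Shannon entropy of the empirical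 frequencies of such tuples over the $n-m+1$ blocks of length $m$ in the first $n$ observations (all frequencies are $0$ if $m>n$, and $0\log 0=0$). With $w_j=\frac1{j(j+1)}$ put, for groups $U_1,\dots,U_r$ of series, $$\hat I_n(U_1,\dots,U_r)=\sum_{m\ge1}\frac{w_m}{m}\sum_{l\ge1}\frac{w_l}{l}\Big(\sum_{j=1}^r\hat h_n([X^{U_j}_{1..m}]^l)-\hat h_n([X^{U_1}_{1..m}]^l,\dots,[X^{U_r}_{1..m}]^l)\Big).$$ **Algorithm CLINk.** It has access to the data only through an estimator $\hat I$ of the sum-information. Sets are scanned in arbitrary fixed orders. $\mathrm{Split}(S)$ starts with $C=\{x\}$, $x$ the first element of $S$, $R=S\setminus C$, and an empty list of candidate splits. While $R\neq\emptyset$: add $(C,R)$ to the list; remove the elements $x$ of $R$ from $R$ one by one without replacement, querying $\hat I(C,R)$ before and after each removal; let $x_{\max}$ be the element whose removal gave the largest decrease (the first element scanned if no decrease is positive); add $x_{\max}$ to $C$ and put $R=S\setminus C$. Starting from the one-cluster clustering $\{\{1,\dots,N\}\}$, CLINk considers all clusterings obtained by $k-1$ successive replacements of one cluster by the two parts of one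 of its candidate splits (all choices of the cluster and of the candidate split are considered), queries $\hat I(U)$ for each resulting $k$-cluster clustering $U$, and outputs one that minimises it. **Theorem.** Let $N\ge 0$ and $k\ge1$. 1. (Consistency.) If $\rho$ is stationary ergodic (otherwise arbitrary; no densities are needed) and its ground-truth clustering has $k$ clusters, then with $\rho$-probability $1$, from some $n$ on, CLINk run with $k$ and the estimator $\hat I_n$, computed from the first $n$ observations, outputs the ground-truth clustering. 2. (Complexity.) Whatever the answers of the estimator, CLINk makes at most $N^{2k-2}$ calls to it. -/

import Mathlib

open MeasureTheory ProbabilityTheory Filter Topology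

/-! ### Stationary ergodic samples

A joint distribution of `N` real-valued time series is a probability measure on
`ℕ → Fin N → ℝ`; the value of the `i`-th series at time `t` is `x t i` (times start at `0`). -/

/-- The number of times `t` at which a window of length `m` fits into a sample of length `n`
(this is `0` if `m > n`). -/
def windowCount (n m : ℕ) : ℕ := n + 1 - m

/-- Among the first `T` terms of the sequence `y`, the fraction that satisfies `p`
(`0` if `T = 0`). -/
noncomputable def frequency {α : Type*} (T : ℕ) (y : ℕ → α) (p : α → Prop) : ℝ :=
  open Classical in (((Finset.range T).filter (fun t => p (y t))).card : ℝ) / T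

/-- The left shift on paths. -/
def shift {N : ℕ} (x : ℕ → Fin N → ℝ) : ℕ → Fin N → ℝ := fun t => x (t + 1)

/-- The block of length `m` of the path `x` that starts at time `t`. -/
def block {N : ℕ} (x : ℕ → Fin N → ℝ) (m t : ℕ) : Fin m → Fin N → ℝ := fun j => x (t + j)

/-- A process distribution is stationary ergodic if it is shift-invariant and, for every length
`m` and every measurable set `S` of blocks of length `m`, the frequency with which the blocks of
the first `n` observations fall in `S` converges almost surely to the probability of `S`. -/
structure IsStationaryErgodic {N : ℕ} (ρ : Measure (ℕ → Fin N → ℝ)) : Prop where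
  stationary : MeasurePreserving shift ρ ρ
  frequencies : ∀ (m : ℕ) (S : Set (Fin m → Fin N → ℝ)), MeasurableSet S →
    ∀ᵐ x ∂ρ, Tendsto (fun n => frequency (windowCount n m) (block x m) (fun b => b ∈ S))
      atTop (𝓝 (ρ.real {y | block y m 0 ∈ S}))

/-! ### Ground-truth clustering -/

/-- The clusters of `U` are mutually independent under `ρ`; a cluster `A` stands for the joint
process of the series with index in `A`. -/
def ClustersIndep {N : ℕ} (ρ : Measure (ℕ → Fin N → ℝ))
    (U : Finpartition (Finset.univ : Finset (Fin N))) : Prop :=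
  iIndepFun (fun (A : {A // A ∈ U.parts}) (x : ℕ → Fin N → ℝ) (i : {i // i ∈ A.1}) (t : ℕ) =>
    x t i.1) ρ

/-- The clusters of `U` are mutually independent, and no proper refinement of `U` has this
property. (`V ≤ U` means that `V` refines `U`.) -/
def IsGroundTruth {N : ℕ} (ρ : Measure (ℕ → Fin N → ℝ))
    (U : Finpartition (Finset.univ : Finset (Fin N))) : Prop :=
  ClustersIndep ρ U ∧ ∀ V : Finpartition (Finset.univ : Finset (Fin N)), V < U → ¬ ClustersIndep ρ V

/-! ### Empirical sum-information -/

/-- For each `m` and `l` a partition of `ℝ^m` into `2^l` Borel cells (`cell m l v` is the index of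
the cell that contains `v`); the partitions become finer as `l` grows, and together they generate
the Borel sigma-algebra of `ℝ^m`. -/
structure QuantizerFamily where
  cell : ∀ m l : ℕ, (Fin m → ℝ) → Fin (2 ^ l)
  measurable_cell : ∀ m l, Measurable (cell m l)
  refines : ∀ m l v w, cell m (l + 1) v = cell m (l + 1) w → cell m l v = cell m l w
  generates : ∀ m : ℕ,
    (⨆ l : ℕ, MeasurableSpace.comap (cell m l) ⊤) = (MeasurableSpace.pi : MeasurableSpace (Fin m → ℝ))

/-- The weights `w_j = 1 / (j (j + 1))`. -/
noncomputable def weight (j : ℕ) : ℝ := 1 / ((j : ℝ) * ((j : ℝ) + 1))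

/-- The Shannon entropy (with `0 log 0 = 0`) of the empirical frequencies of the first `T` terms of
a sequence over a finite alphabet. -/
noncomputable def empEntropy {α : Type*} [Fintype α] (T : ℕ) (y : ℕ → α) : ℝ :=
  ∑ a : α, Real.negMulLog (frequency T y (fun b => b = a))

/-- The `l`-th quantized version of the block of length `m` starting at time `t`, jointly for the
series with index in `A`: each series of `A` is quantized. -/
def quantizedBlock {N : ℕ} (B : QuantizerFamily) (x : ℕ → Fin N → ℝ) (m l : ℕ)
    (A : Finset (Fin N)) (t : ℕ) : {i // i ∈ A} → Fin (2 ^ l) :=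
  fun i => B.cell m l (fun j : Fin m => x (t + j) i.1)

/-- The summand with indices `m`, `l` of the empirical sum-information of the groups
`U_1, …, U_r` of series: the sum of the empirical entropies of the groups minus their joint
empirical entropy. -/
noncomputable def empInfoTerm {N : ℕ} (B : QuantizerFamily) (n : ℕ) (x : ℕ → Fin N → ℝ)
    (U : List (Finset (Fin N))) (m l : ℕ) : ℝ :=
  (∑ j : Fin U.length, empEntropy (windowCount n m) (fun t => quantizedBlock B x m l (U.get j) t))
    - empEntropy (windowCount n m)
        (fun t (j : Fin U.length) => quantizedBlock B x m l (U.get j) t)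

/-- The empirical sum-information of the groups `U_1, …, U_r`, computed from the first `n`
observations of each series. The sums run over `m, l ≥ 1`, hence the shift of the indices. -/
noncomputable def empSumInfo {N : ℕ} (B : QuantizerFamily) (n : ℕ) (x : ℕ → Fin N → ℝ)
    (U : List (Finset (Fin N))) : ℝ :=
  ∑' m : ℕ, 1 / ((m + 1 : ℕ) : ℝ) * weight (m + 1) *
    ∑' l : ℕ, 1 / ((l + 1 : ℕ) : ℝ) * weight (l + 1) * empInfoTerm B n x U (m + 1) (l + 1)

/-! ### Programs that query an estimator, and the number of queries they make -/

/-- A program that either returns a value or sends a query in `Q` to an estimator and continues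
with the answer in `R`. -/
inductive QueryProg (Q R α : Type) : Type
  | ret (a : α) : QueryProg Q R α
  | ask (q : Q) (next : R → QueryProg Q R α) : QueryProg Q R α

namespace QueryProg

variable {Q R α β : Type}

/-- Run the first program and continue with its value. -/
def bind : QueryProg Q R α → (α → QueryProg Q R β) → QueryProg Q R β
  | ret a, f => f a
  | ask q next, f => ask q (fun r => (next r).bind f)

/-- The output of the program when queries are answered by `est`. -/
def output (est : Q → R) : QueryProg Q R α → α
  | ret a => a
  | ask q next => (next (est q)).output est

/-- The number of queries that the program makes when they are answered by `est`. -/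
def calls (est : Q → R) : QueryProg Q R α → ℕ
  | ret _ => 0
  | ask q next => (next (est q)).calls est + 1

/-- Run `f` on each element of a list and concatenate the resulting lists. -/
def forEach (f : α → QueryProg Q R (List β)) : List α → QueryProg Q R (List β)
  | [] => ret []
  | a :: l => (f a).bind fun b => (forEach f l).bind fun c => ret (b ++ c)

end QueryProg

/-! ### The algorithm -/

/-- For each set of series an arbitrary order in which the algorithm goes through it. -/
structure ScanOrder (N : ℕ) where
  list : Finset (Fin N) → List (Fin N)
  nodup : ∀ S, (list S).Nodup
  mem_list : ∀ S i, i ∈ list S ↔ i ∈ S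

/-- A program whose queries are lists `U_1, …, U_r` of groups of series, each answered by an
estimate of the sum-information of `U_1, …, U_r`. -/
abbrev ClusterProg (N : ℕ) (α : Type) : Type := QueryProg (List (Finset (Fin N))) ℝ α

namespace Clink

open QueryProg

variable {N : ℕ}

/-- The inner `for` loop of `split`. The list holds the elements still to be scanned, `R` is the
current remainder, `d` the largest change so far and `xmax` the element that caused it. Both
estimates are queried anew for each element. -/
noncomputable def maxChange (C : Finset (Fin N)) :
    List (Fin N) → Finset (Fin N) → ℝ → Fin N → ClusterProg N (Fin N)
  | [], _, _, xmax => ret xmax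
  | a :: rest, R, d, xmax =>
      ask [C, R] fun r =>
      ask [C, R.erase a] fun r' =>
        if d < r - r' then maxChange C rest (R.erase a) (r - r') a
        else maxChange C rest (R.erase a) d xmax

/-- The `while` loop of `split` on the set `S` with current cluster `C`: as long as
`R = S \ C` is nonempty, record the candidate split `(C, R)` and move the maximal-change element
of `R` to `C`. The first argument bounds the number of iterations. -/
noncomputable def splitLoop (ord : ScanOrder N) (S : Finset (Fin N)) :
    ℕ → Finset (Fin N) → ClusterProg N (List (Finset (Fin N) × Finset (Fin N)))
  | 0, _ => ret []
  | fuel + 1, C =>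
      match ord.list (S \ C) with
      | [] => ret []
      | a :: rest =>
          (maxChange C (a :: rest) (S \ C) 0 a).bind fun xmax =>
          (splitLoop ord S fuel (insert xmax C)).bind fun P =>
          ret ((C, S \ C) :: P)

/-- The list of candidate splits of `S`, starting with the cluster of one element of `S`. Each
iteration of the loop makes the cluster larger, so `|S|` iterations always suffice. -/
noncomputable def split (ord : ScanOrder N) (S : Finset (Fin N)) :
    ClusterProg N (List (Finset (Fin N) × Finset (Fin N))) :=
  match ord.list S with
  | [] => ret []
  | a :: _ => splitLoop ord S S.card {a}

/-- All clusterings obtained from the clustering `pre ++ post` by replacing one of the clusters in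
`post` by the two parts of one of its candidate splits. -/
noncomputable def refineOne (ord : ScanOrder N) :
    List (Finset (Fin N)) → List (Finset (Fin N)) → ClusterProg N (List (List (Finset (Fin N))))
  | _, [] => ret []
  | pre, A :: post =>
      (split ord A).bind fun P =>
      (refineOne ord (pre ++ [A]) post).bind fun rest =>
      ret (P.map (fun CR => pre ++ CR.1 :: CR.2 :: post) ++ rest)

/-- All clusterings obtained from the trivial clustering by `j` successive splits; they have
`j + 1` clusters. -/
noncomputable def candidates (ord : ScanOrder N) :
    ℕ → ClusterProg N (List (List (Finset (Fin N))))
  | 0 => ret [[Finset.univ]]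
  | j + 1 => (candidates ord j).bind (forEach (refineOne ord []))

/-- Compare the remaining clusterings with the best one so far and its estimate. -/
noncomputable def selectLoop :
    List (Finset (Fin N)) → ℝ → List (List (Finset (Fin N))) → ClusterProg N (List (Finset (Fin N)))
  | best, _, [] => ret best
  | best, v, U :: rest => ask U fun v' =>
      if v' < v then selectLoop U v' rest else selectLoop best v rest

/-- A clustering in the list that minimises the estimate. -/
noncomputable def selectMin :
    List (List (Finset (Fin N))) → ClusterProg N (List (Finset (Fin N)))
  | [] => ret []
  | U :: rest => ask U fun v => selectLoop U v rest

end Clink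

/-- The algorithm CLINk for `N` series and `k` clusters. -/
noncomputable def clink {N : ℕ} (ord : ScanOrder N) (k : ℕ) : ClusterProg N (List (Finset (Fin N))) :=
  (Clink.candidates ord (k - 1)).bind Clink.selectMin

/-! Consistency. Almost surely the empirical sum-information of every list of groups converges to a
limit `sumInfo` (`IsStationaryErgodic.tendsto_empSumInfo`): each summand is a continuous function of
finitely many frequencies. A level-`l` quantizer has `2^l` cells whatever the block length, so
entropies grow at most linearly in `l`, uniformly in `m`, and dominated convergence applies. Each
summand of the limit is a relative entropy, so the limit is nonnegative. It vanishes exactly when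
all quantized blocks are independent, that is, when the groups are independent as processes
(`IsStationaryErgodic.sumInfo_eq_zero_iff`).

Only finitely many comparisons matter, so for large `n` the estimates respect every relevant strict
inequality between limits (`Faithful`); ties may be broken in any way. Let `C` be a proper nonempty
part of a ground-truth cluster `G ⊆ S`. Removing a series outside `G` from the remainder leaves the
limit unchanged (`sumInfo_pair_inter`), while removing all series lowers it from a positive value to
`0`. Hence some removal has a positive effect, every such removal is of a member of `G`, and the
series moved lies in `G` (`moved_mem_groundTruth`). So `C` grows to exactly `G`, and `k - 1` splits
can reach the ground truth, where the limit is `0`. A minimiser of the estimate must then also have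
limit `0`. Its clusters are independent, so the ground truth refines it
(`IsGroundTruth.le_of_clustersIndep`), and equal cardinality forces equality.

Complexity. Queries plus produced candidates is a quantity that satisfies clean recursions: it is at
most `|S|^2` for one split, at most `N^2` for refining one clustering, and at most `N^(2j)` after
`j` rounds. The candidates counted in the last round pay for the final selection. -/

namespace QueryProg

variable {Q R α β : Type}

@[simp] theorem output_ret (est : Q → R) (a : α) : (ret a : QueryProg Q R α).output est = a := rfl

@[simp] theorem output_ask (est : Q → R) (q : Q) (f : R → QueryProg Q R α) :
    (ask q f).output est = (f (est q)).output est := rfl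

@[simp] theorem calls_ret (est : Q → R) (a : α) : (ret a : QueryProg Q R α).calls est = 0 := rfl

@[simp] theorem calls_ask (est : Q → R) (q : Q) (f : R → QueryProg Q R α) :
    (ask q f).calls est = (f (est q)).calls est + 1 := rfl

@[simp] theorem output_bind (est : Q → R) (p : QueryProg Q R α) (f : α → QueryProg Q R β) :
    (p.bind f).output est = (f (p.output est)).output est := by
  induction p with
  | ret a => rfl
  | ask q next ih => exact ih _

@[simp] theorem calls_bind (est : Q → R) (p : QueryProg Q R α) (f : α → QueryProg Q R β) :
    (p.bind f).calls est = p.calls est + (f (p.output est)).calls est := by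
  induction p with
  | ret a => simp [bind]
  | ask q next ih => simp only [bind, calls_ask, ih, output_ask]; omega

theorem output_forEach (est : Q → R) (f : α → QueryProg Q R (List β)) (l : List α) :
    (forEach f l).output est = l.flatMap fun a => (f a).output est := by
  induction l with
  | nil => rfl
  | cons a l ih => simp [forEach, ih]

theorem calls_forEach (est : Q → R) (f : α → QueryProg Q R (List β)) (l : List α) :
    (forEach f l).calls est = (l.map fun a => (f a).calls est).sum := by
  induction l with
  | nil => rfl
  | cons a l ih => simp [forEach, ih]

end QueryProg

/-! ### Query counts and the shape of candidate clusterings -/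

namespace Clink

open QueryProg

variable {N : ℕ}

theorem calls_maxChange (est : List (Finset (Fin N)) → ℝ) (C : Finset (Fin N)) (L : List (Fin N))
    (R : Finset (Fin N)) (d : ℝ) (x : Fin N) :
    (maxChange C L R d x).calls est = 2 * L.length := by
  induction L generalizing R d x with
  | nil => rfl
  | cons a L ih =>
    simp only [maxChange, calls_ask, List.length_cons]
    split_ifs <;> rw [ih] <;> ring

theorem output_maxChange_mem (est : List (Finset (Fin N)) → ℝ) (C : Finset (Fin N))
    (L : List (Fin N)) (R : Finset (Fin N)) (d : ℝ) (x : Fin N) :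
    (maxChange C L R d x).output est ∈ x :: L := by
  induction L generalizing R d x with
  | nil => simp [maxChange]
  | cons a L ih =>
    simp only [maxChange, output_ask]
    split_ifs
    · exact List.mem_cons_of_mem _ (ih _ _ _)
    · rcases List.mem_cons.1 (ih (R.erase a) d x) with h | h
      · rw [h]; exact List.mem_cons_self
      · exact List.mem_cons_of_mem _ (List.mem_cons_of_mem _ h)

/-- The element moved to `C` in one iteration of the loop of `split` on `S`. -/
noncomputable def moved (ord : ScanOrder N) (est : List (Finset (Fin N)) → ℝ)
    (S C : Finset (Fin N)) (a : Fin N) : Fin N :=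
  (maxChange C (ord.list (S \ C)) (S \ C) 0 a).output est

theorem moved_mem {ord : ScanOrder N} {S C : Finset (Fin N)} {a : Fin N} {L : List (Fin N)}
    (h : ord.list (S \ C) = a :: L) (est : List (Finset (Fin N)) → ℝ) :
    moved ord est S C a ∈ S \ C := by
  rw [← ord.mem_list, h]
  have := output_maxChange_mem est C (ord.list (S \ C)) (S \ C) 0 a
  rw [h] at this
  simpa [moved, h] using this

theorem output_splitLoop_succ {ord : ScanOrder N} {S C : Finset (Fin N)} {a : Fin N}
    {L : List (Fin N)} (h : ord.list (S \ C) = a :: L) (est : List (Finset (Fin N)) → ℝ)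
    (fuel : ℕ) :
    (splitLoop ord S (fuel + 1) C).output est =
      (C, S \ C) :: (splitLoop ord S fuel (insert (moved ord est S C a) C)).output est := by
  simp [splitLoop, h, moved]

theorem calls_splitLoop_succ {ord : ScanOrder N} {S C : Finset (Fin N)} {a : Fin N}
    {L : List (Fin N)} (h : ord.list (S \ C) = a :: L) (est : List (Finset (Fin N)) → ℝ)
    (fuel : ℕ) :
    (splitLoop ord S (fuel + 1) C).calls est =
      2 * (S \ C).card +
        (splitLoop ord S fuel (insert (moved ord est S C a) C)).calls est := by
  have hcard : (S \ C).card = (a :: L).length := by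
    rw [← h, ← List.toFinset_card_of_nodup (ord.nodup _)]
    congr 1; ext i; simp only [List.mem_toFinset, ord.mem_list]
  simp [splitLoop, h, moved, hcard, calls_maxChange]

theorem card_sdiff_insert_add_one {S C : Finset (Fin N)} {x : Fin N} (hx : x ∈ S \ C) :
    (S \ insert x C).card + 1 = (S \ C).card := by
  rw [Finset.sdiff_insert, Finset.card_erase_add_one hx]

/-- With `r` elements remaining, an iteration costs `2r` queries and yields one candidate, and `(r +
1)^2 = r^2 + (2r + 1)`. Candidates are counted with the queries because each one causes further
queries later. -/
theorem calls_add_length_splitLoop (ord : ScanOrder N) (est : List (Finset (Fin N)) → ℝ)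
    (S : Finset (Fin N)) (fuel : ℕ) (C : Finset (Fin N)) :
    (splitLoop ord S fuel C).calls est + ((splitLoop ord S fuel C).output est).length + 1 ≤
      ((S \ C).card + 1) ^ 2 := by
  induction fuel generalizing C with
  | zero => simpa [splitLoop] using Nat.one_le_pow _ _ (Nat.succ_pos _)
  | succ fuel ih =>
    rcases h : ord.list (S \ C) with _ | ⟨a, L⟩
    · simpa [splitLoop, h] using Nat.one_le_pow _ _ (Nat.succ_pos _)
    · have h1 := ih (insert (moved ord est S C a) C)
      rw [card_sdiff_insert_add_one (moved_mem h est)] at h1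
      rw [calls_splitLoop_succ h, output_splitLoop_succ h, List.length_cons]
      nlinarith

theorem calls_add_length_split (ord : ScanOrder N) (est : List (Finset (Fin N)) → ℝ)
    (S : Finset (Fin N)) :
    (split ord S).calls est + ((split ord S).output est).length ≤ S.card ^ 2 := by
  rcases h : ord.list S with _ | ⟨a, L⟩
  · simp [split, h]
  · have ha : a ∈ S := by rw [← ord.mem_list, h]; exact List.mem_cons_self
    have h1 := calls_add_length_splitLoop ord est S S.card {a}
    rw [Finset.sdiff_singleton_eq_erase, Finset.card_erase_add_one ha] at h1
    simp only [split, h]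
    omega

theorem mem_output_splitLoop {ord : ScanOrder N} {est : List (Finset (Fin N)) → ℝ}
    {S : Finset (Fin N)} {fuel : ℕ} {C : Finset (Fin N)} (hC : C.Nonempty) (hCS : C ⊆ S)
    {D R : Finset (Fin N)} (h : (D, R) ∈ (splitLoop ord S fuel C).output est) :
    D.Nonempty ∧ D ⊂ S ∧ R = S \ D := by
  induction fuel generalizing C with
  | zero => simp [splitLoop] at h
  | succ fuel ih =>
    rcases hL : ord.list (S \ C) with _ | ⟨a, L⟩
    · simp [splitLoop, hL] at h
    · rw [output_splitLoop_succ hL, List.mem_cons] at h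
      have hm := Finset.mem_sdiff.1 (moved_mem hL est)
      rcases h with h | h
      · obtain ⟨rfl, rfl⟩ := Prod.mk.inj h
        exact ⟨hC, (Finset.ssubset_iff_of_subset hCS).2 ⟨_, hm⟩, rfl⟩
      · exact ih (Finset.insert_nonempty _ _)
          (Finset.insert_subset hm.1 hCS) h

theorem mem_output_split {ord : ScanOrder N} {est : List (Finset (Fin N)) → ℝ}
    {S D R : Finset (Fin N)} (h : (D, R) ∈ (split ord S).output est) :
    D.Nonempty ∧ D ⊂ S ∧ R = S \ D := by
  rcases hL : ord.list S with _ | ⟨a, L⟩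
  · simp [split, hL] at h
  · simp only [split, hL] at h
    have ha : a ∈ S := by rw [← ord.mem_list, hL]; exact List.mem_cons_self
    exact mem_output_splitLoop (Finset.singleton_nonempty a) (by simpa using ha) h

theorem mem_output_refineOne {ord : ScanOrder N} {est : List (Finset (Fin N)) → ℝ}
    {pre L V : List (Finset (Fin N))} :
    V ∈ (refineOne ord pre L).output est ↔ ∃ l₁ A l₂ C R, L = l₁ ++ A :: l₂ ∧
      (C, R) ∈ (split ord A).output est ∧ V = pre ++ l₁ ++ C :: R :: l₂ := by
  induction L generalizing pre with
  | nil => simp [refineOne]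
  | cons A L ih =>
    simp only [refineOne, output_bind, output_ret, List.mem_append, List.mem_map, Prod.exists, ih]
    constructor
    · rintro (⟨C, R, h, rfl⟩ | ⟨l₁, A', l₂, C, R, rfl, h, rfl⟩)
      · exact ⟨[], A, L, C, R, rfl, h, by simp⟩
      · exact ⟨A :: l₁, A', l₂, C, R, rfl, h, by simp⟩
    · rintro ⟨l₁, A', l₂, C, R, hL, h, rfl⟩
      rcases l₁ with _ | ⟨B, l₁⟩
      · obtain ⟨rfl, rfl⟩ := List.cons.inj hL
        exact Or.inl ⟨C, R, h, by simp⟩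
      · obtain ⟨rfl, rfl⟩ := List.cons.inj hL
        exact Or.inr ⟨l₁, A', l₂, C, R, rfl, h, by simp⟩

/-- The bounds for the single clusters add up, and a sum of squares is at most the square of the
sum. -/
theorem calls_add_length_refineOne (ord : ScanOrder N) (est : List (Finset (Fin N)) → ℝ)
    (pre L : List (Finset (Fin N))) :
    (refineOne ord pre L).calls est + ((refineOne ord pre L).output est).length ≤
      (L.map Finset.card).sum ^ 2 := by
  induction L generalizing pre with
  | nil => simp [refineOne]
  | cons A L ih =>
    have h1 := ih (pre ++ [A])
    have h2 := calls_add_length_split ord est A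
    simp only [refineOne, calls_bind, calls_ret, output_bind, output_ret, List.length_append,
      List.length_map, List.map_cons, List.sum_cons]
    nlinarith [Nat.zero_le (A.card * (L.map Finset.card).sum)]

/-- The clusters of the list are non-empty, pairwise disjoint and cover all series. -/
structure IsClustering (L : List (Finset (Fin N))) : Prop where
  nonempty : ∀ A ∈ L, A.Nonempty
  disjoint : L.Pairwise Disjoint
  cover : ∀ i, ∃ A ∈ L, i ∈ A

theorem IsClustering.nodup {L : List (Finset (Fin N))} (h : IsClustering L) : L.Nodup := by
  refine h.disjoint.imp_of_mem ?_
  rintro A B hA - hAB rfl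
  exact (h.nonempty A hA).ne_empty (by simpa using hAB)

theorem IsClustering.disjoint_of_ne {L : List (Finset (Fin N))} (h : IsClustering L)
    {A B : Finset (Fin N)} (hA : A ∈ L) (hB : B ∈ L) (hAB : A ≠ B) : Disjoint A B :=
  h.disjoint.forall hA hB hAB

/-- The partition whose parts are the members of the list. -/
def IsClustering.toFinpartition {L : List (Finset (Fin N))} (h : IsClustering L) :
    Finpartition (Finset.univ : Finset (Fin N)) where
  parts := L.toFinset
  supIndep := by
    rw [Finset.supIndep_iff_pairwiseDisjoint]
    intro A hA B hB hAB
    exact h.disjoint_of_ne (by simpa using hA) (by simpa using hB) hAB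
  sup_parts := by
    ext i
    obtain ⟨A, hA, hi⟩ := h.cover i
    simp only [Finset.mem_sup, List.mem_toFinset, id, Finset.mem_univ, iff_true]
    exact ⟨A, hA, hi⟩
  bot_notMem hb := (h.nonempty ∅ (by simpa using hb)).ne_empty rfl

theorem IsClustering.val_parts_toFinpartition {L : List (Finset (Fin N))} (h : IsClustering L) :
    h.toFinpartition.parts.val = (L : Multiset (Finset (Fin N))) := by
  simp [toFinpartition, List.toFinset_val, h.nodup.dedup]

theorem IsClustering.sum_card {L : List (Finset (Fin N))} (h : IsClustering L) :
    (L.map Finset.card).sum = N := by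
  have h1 := h.toFinpartition.sum_card_parts
  rw [Finset.sum, h.val_parts_toFinpartition] at h1
  simpa using h1

theorem IsClustering.split {l₁ l₂ : List (Finset (Fin N))} {A C : Finset (Fin N)}
    (h : IsClustering (l₁ ++ A :: l₂)) (hC : C.Nonempty) (hCA : C ⊂ A) :
    IsClustering (l₁ ++ C :: (A \ C) :: l₂) := by
  obtain ⟨h1, h2, h3⟩ := h
  refine ⟨?_, ?_, ?_⟩
  · intro B hB
    simp only [List.mem_append, List.mem_cons] at hB h1
    rcases hB with hB | rfl | rfl | hB
    · exact h1 B (by tauto)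
    · exact hC
    · exact Finset.sdiff_nonempty.2 hCA.2
    · exact h1 B (by tauto)
  · simp only [List.pairwise_append, List.pairwise_cons, List.mem_cons] at h2 ⊢
    obtain ⟨ha, ⟨hb, hc⟩, hd⟩ := h2
    refine ⟨ha, ⟨?_, ?_, hc⟩, ?_⟩
    · rintro B (rfl | hB)
      · exact Finset.disjoint_sdiff
      · exact (hb B hB).mono_left hCA.1
    · exact fun B hB => (hb B hB).mono_left Finset.sdiff_subset
    · rintro B hB D (rfl | rfl | hD)
      · exact (hd B hB A (Or.inl rfl)).mono_right hCA.1
      · exact (hd B hB A (Or.inl rfl)).mono_right Finset.sdiff_subset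
      · exact hd B hB D (Or.inr hD)
  · intro i
    obtain ⟨B, hB, hi⟩ := h3 i
    simp only [List.mem_append, List.mem_cons] at hB ⊢
    rcases hB with hB | rfl | hB
    · exact ⟨B, Or.inl hB, hi⟩
    · by_cases hiC : i ∈ C
      · exact ⟨C, by tauto, hiC⟩
      · exact ⟨B \ C, by tauto, Finset.mem_sdiff.2 ⟨hi, hiC⟩⟩
    · exact ⟨B, by tauto, hi⟩

theorem isClustering_of_mem_refineOne {ord : ScanOrder N} {est : List (Finset (Fin N)) → ℝ}
    {L V : List (Finset (Fin N))} (hL : IsClustering L)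
    (h : V ∈ (refineOne ord [] L).output est) : IsClustering V ∧ V.length = L.length + 1 := by
  obtain ⟨l₁, A, l₂, C, R, rfl, hCR, rfl⟩ := mem_output_refineOne.1 h
  obtain ⟨hC, hCA, rfl⟩ := mem_output_split hCR
  refine ⟨hL.split hC hCA, ?_⟩
  simp; omega

theorem mem_output_candidates_succ {ord : ScanOrder N} {est : List (Finset (Fin N)) → ℝ} {j : ℕ}
    {V : List (Finset (Fin N))} :
    V ∈ (candidates ord (j + 1)).output est ↔
      ∃ L ∈ (candidates ord j).output est, V ∈ (refineOne ord [] L).output est := by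
  simp [candidates, output_forEach]

theorem isClustering_of_mem_candidates [NeZero N] {ord : ScanOrder N}
    {est : List (Finset (Fin N)) → ℝ} {j : ℕ} {V : List (Finset (Fin N))}
    (h : V ∈ (candidates ord j).output est) : IsClustering V ∧ V.length = j + 1 := by
  induction j generalizing V with
  | zero =>
    obtain rfl : V = [Finset.univ] := by simpa [candidates] using h
    exact ⟨⟨by simp [Finset.univ_nonempty], by simp, by simp⟩, rfl⟩
  | succ j ih =>
    obtain ⟨L, hL, hV⟩ := mem_output_candidates_succ.1 h
    obtain ⟨h1, h2⟩ := ih hL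
    rw [← h2]
    exact isClustering_of_mem_refineOne h1 hV

/-- Each clustering of round `j` is traded for at most `N^2` queries and new clusterings, since its
cluster sizes add up to `N`. Multiplying the earlier queries by `N^2 ≥ 1` as well closes the
induction. -/
theorem calls_add_length_candidates [NeZero N] (ord : ScanOrder N)
    (est : List (Finset (Fin N)) → ℝ) (j : ℕ) :
    (candidates ord j).calls est + ((candidates ord j).output est).length ≤ N ^ (2 * j) := by
  induction j with
  | zero => simp [candidates]
  | succ j ih =>
    set Ls := (candidates ord j).output est with hLs
    have key : (Ls.map fun L => (refineOne ord [] L).calls est).sum +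
        (Ls.flatMap fun L => (refineOne ord [] L).output est).length ≤ Ls.length * N ^ 2 := by
      rw [List.length_flatMap, ← List.sum_map_add, ← List.length_map (as := Ls)
        (f := fun L => (refineOne ord [] L).calls est +
          ((refineOne ord [] L).output est).length), ← smul_eq_mul]
      refine List.sum_le_card_nsmul _ _ fun c hc => ?_
      obtain ⟨L, hL, rfl⟩ := List.mem_map.1 hc
      refine (calls_add_length_refineOne ord est [] L).trans_eq ?_
      rw [(isClustering_of_mem_candidates hL).1.sum_card]
    have hN : 1 ≤ N ^ 2 := Nat.one_le_pow _ _ (Nat.pos_of_ne_zero (NeZero.ne N))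
    simp only [candidates, calls_bind, output_bind, calls_forEach, output_forEach, ← hLs]
    calc _ ≤ (candidates ord j).calls est * N ^ 2 + Ls.length * N ^ 2 := by
          rw [add_assoc]; exact add_le_add (Nat.le_mul_of_pos_right _ hN) key
      _ = ((candidates ord j).calls est + Ls.length) * N ^ 2 := by ring
      _ ≤ N ^ (2 * j) * N ^ 2 := Nat.mul_le_mul_right _ ih
      _ = N ^ (2 * (j + 1)) := by ring

/-! ### Selection of a minimiser -/

theorem calls_selectLoop (est : List (Finset (Fin N)) → ℝ) (best : List (Finset (Fin N))) (v : ℝ)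
    (Us : List (List (Finset (Fin N)))) : (selectLoop best v Us).calls est = Us.length := by
  induction Us generalizing best v with
  | nil => rfl
  | cons U Us ih => simp only [selectLoop, calls_ask]; split_ifs <;> simp [ih]

theorem calls_selectMin (est : List (Finset (Fin N)) → ℝ) (Us : List (List (Finset (Fin N)))) :
    (selectMin Us).calls est = Us.length := by
  cases Us with
  | nil => rfl
  | cons U Us => simp [selectMin, calls_selectLoop]

theorem output_selectLoop (est : List (Finset (Fin N)) → ℝ) (best : List (Finset (Fin N)))
    (Us : List (List (Finset (Fin N)))) :
    (selectLoop best (est best) Us).output est ∈ best :: Us ∧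
      ∀ U ∈ best :: Us, est ((selectLoop best (est best) Us).output est) ≤ est U := by
  induction Us generalizing best with
  | nil => simp [selectLoop]
  | cons U Us ih =>
    simp only [selectLoop, output_ask]
    split_ifs with h
    · obtain ⟨h1, h2⟩ := ih U
      refine ⟨List.mem_cons_of_mem _ h1, fun V hV => ?_⟩
      rcases List.mem_cons.1 hV with rfl | hV
      · exact (h2 U List.mem_cons_self).trans h.le
      · exact h2 V hV
    · obtain ⟨h1, h2⟩ := ih best
      refine ⟨?_, fun V hV => ?_⟩
      · simp only [List.mem_cons] at h1 ⊢; tauto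
      · rcases List.mem_cons.1 hV with rfl | hV
        · exact h2 V List.mem_cons_self
        rcases List.mem_cons.1 hV with rfl | hV
        · exact (h2 best List.mem_cons_self).trans (not_lt.1 h)
        · exact h2 V (List.mem_cons_of_mem _ hV)

theorem output_selectMin (est : List (Finset (Fin N)) → ℝ) {Us : List (List (Finset (Fin N)))}
    (h : Us ≠ []) :
    (selectMin Us).output est ∈ Us ∧ ∀ U ∈ Us, est ((selectMin Us).output est) ≤ est U := by
  cases Us with
  | nil => exact absurd rfl h
  | cons U Us => exact output_selectLoop est U Us

end Clink

/-! ### The bound on the number of queries -/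

theorem calls_clink_le {N : ℕ} (ord : ScanOrder N) {k : ℕ} (hk : 1 ≤ k)
    (est : List (Finset (Fin N)) → ℝ) : (clink ord k).calls est ≤ N ^ (2 * k - 2) := by
  obtain ⟨j, rfl⟩ := Nat.exists_eq_add_of_le' hk
  simp only [clink, QueryProg.calls_bind, Clink.calls_selectMin, Nat.add_sub_cancel]
  rw [show 2 * (j + 1) - 2 = 2 * j by omega]
  rcases N with _ | N
  -- Without series the initial cluster is empty, so the clustering lemmas do not apply. There is
  -- one candidate for `j = 0` and none afterwards, in agreement with `0 ^ (2 * j)`.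
  · have hlist (S : Finset (Fin 0)) : ord.list S = [] :=
      List.eq_nil_iff_forall_not_mem.2 fun i => i.elim0
    have hone (pre L : List (Finset (Fin 0))) : Clink.refineOne ord pre L = QueryProg.ret [] := by
      induction L generalizing pre with
      | nil => rfl
      | cons A L ih => simp [Clink.refineOne, Clink.split, hlist, ih, QueryProg.bind]
    suffices h : (Clink.candidates ord j).calls est = 0 ∧
        ((Clink.candidates ord j).output est).length = 0 ^ (2 * j) by omega
    clear hk
    induction j with
    | zero => simp [Clink.candidates]
    | succ j ih =>
      simp [Clink.candidates, QueryProg.calls_forEach, QueryProg.output_forEach, hone, ih.1]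
  · exact Clink.calls_add_length_candidates ord est j

/-! ### Entropy of finite-valued random variables -/

open InformationTheory in
/-- The difference between the sum of the entropies of the marginals and the joint entropy is the
relative entropy of the joint distribution with respect to the product of the marginals. -/
theorem sum_negMulLog_sub_negMulLog_eq {ι : Type*} [Fintype ι] {α : ι → Type*}
    [∀ j, Fintype (α j)] [DecidableEq ι] (p : (∀ j, α j) → ℝ) (q : ∀ j, α j → ℝ)
    (hp : ∀ a, 0 ≤ p a) (hp1 : ∑ a, p a = 1)
    (hle : ∀ a j, p a ≤ q j (a j))
    (hq : ∀ j (g : α j → ℝ), ∑ a, p a * g (a j) = ∑ b, q j b * g b) :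
    (∑ j, ∑ b, Real.negMulLog (q j b)) - ∑ a, Real.negMulLog (p a) =
      ∑ a, (∏ j, q j (a j)) * klFun (p a / ∏ j, q j (a j)) := by
  have hq1 : ∑ a : ∀ j, α j, ∏ j, q j (a j) = 1 := by
    rw [← Fintype.piFinset_univ, ← Finset.prod_univ_sum]
    refine Finset.prod_eq_one fun j _ => ?_
    have := hq j 1
    simpa [hp1] using this.symm
  -- The correction `∏ q - p` comes from `klFun x = x * log x + 1 - x`; it cancels in the sum over
  -- `a` because both weights have total mass `1`.
  have hterm (a : ∀ j, α j) : (∏ j, q j (a j)) * klFun (p a / ∏ j, q j (a j)) =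
      -(∑ j, p a * Real.log (q j (a j))) - Real.negMulLog (p a) + (∏ j, q j (a j)) - p a := by
    rcases (hp a).eq_or_lt with h0 | hpos
    · simp [← h0, klFun_zero]
    · have hqpos j : 0 < q j (a j) := hpos.trans_le (hle a j)
      have hprod : 0 < ∏ j, q j (a j) := Finset.prod_pos fun j _ => hqpos j
      rw [klFun_apply, Real.log_div hpos.ne' hprod.ne', Real.log_prod fun j _ => (hqpos j).ne',
        ← Finset.mul_sum, Real.negMulLog]
      field_simp
      ring
  have hmarg (j : ι) : ∑ b, Real.negMulLog (q j b) = -∑ a, p a * Real.log (q j (a j)) := by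
    rw [hq j (fun b => Real.log (q j b)), ← Finset.sum_neg_distrib]
    simp [Real.negMulLog]
  simp only [hterm, Finset.sum_add_distrib, Finset.sum_sub_distrib, hq1, hp1, hmarg,
    Finset.sum_neg_distrib]
  rw [Finset.sum_comm]
  ring

section Entropy

variable {Ω : Type*} [MeasurableSpace Ω]

/-- The Shannon entropy of a random variable with values in a finite type. -/
noncomputable def entropy (μ : Measure Ω) {α : Type*} [Fintype α] (X : Ω → α) : ℝ :=
  ∑ a, Real.negMulLog (μ.real (X ⁻¹' {a}))

theorem entropy_comp_of_injective (μ : Measure Ω) {α β : Type*} [Fintype α] [Fintype β]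
    (X : Ω → α) {e : α → β} (he : Function.Injective e) :
    entropy μ (fun ω => e (X ω)) = entropy μ X := by
  refine (Fintype.sum_of_injective e he _ _ (fun b hb => ?_) fun a => ?_).symm
  · rw [show (fun ω => e (X ω)) ⁻¹' {b} = ∅ from ?_]
    · simp
    · ext ω
      simpa using fun h => hb ⟨_, h⟩
  · congr 2
    ext ω
    simp [he.eq_iff]

variable (μ : Measure Ω) [IsProbabilityMeasure μ]

theorem sum_measureReal_preimage_mul {α β : Type*} [Fintype α] [Fintype β] [DecidableEq β]
    [MeasurableSpace α] [MeasurableSingletonClass α]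
    {X : Ω → α} (hX : Measurable X) (e : α → β) (g : β → ℝ) :
    ∑ a, μ.real (X ⁻¹' {a}) * g (e a) = ∑ b, μ.real ((fun ω => e (X ω)) ⁻¹' {b}) * g b := by
  rw [← Finset.sum_fiberwise Finset.univ e]
  refine Finset.sum_congr rfl fun b _ => ?_
  have h : (fun ω => e (X ω)) ⁻¹' {b} =
      X ⁻¹' ((Finset.univ.filter fun a => e a = b : Finset α) : Set α) := by
    ext ω; simp
  rw [h, ← sum_measureReal_preimage_singleton _ fun a _ => hX (measurableSet_singleton a),
    Finset.sum_mul]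
  refine Finset.sum_congr rfl fun a ha => ?_
  rw [(Finset.mem_filter.1 ha).2]

theorem sum_measureReal_preimage {α : Type*} [Fintype α] [MeasurableSpace α]
    [MeasurableSingletonClass α] {X : Ω → α} (hX : Measurable X) :
    ∑ a, μ.real (X ⁻¹' {a}) = 1 := by
  rw [sum_measureReal_preimage_singleton _ fun a _ => hX (measurableSet_singleton a)]
  simp

theorem entropy_prod {α β : Type*} [Fintype α] [Fintype β] [MeasurableSpace α] [MeasurableSpace β]
    [MeasurableSingletonClass α] [MeasurableSingletonClass β] {X : Ω → α} {Y : Ω → β}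
    (hX : Measurable X) (hY : Measurable Y) (h : IndepFun X Y μ) :
    entropy μ (fun ω => (X ω, Y ω)) = entropy μ X + entropy μ Y := by
  have hab (a : α) (b : β) : μ.real ((fun ω => (X ω, Y ω)) ⁻¹' {(a, b)}) =
      μ.real (X ⁻¹' {a}) * μ.real (Y ⁻¹' {b}) := by
    rw [← Set.singleton_prod_singleton, Set.mk_preimage_prod, measureReal_def,
      h.measure_inter_preimage_eq_mul _ _ (measurableSet_singleton a) (measurableSet_singleton b),
      ENNReal.toReal_mul, measureReal_def, measureReal_def]
  simp only [entropy, Fintype.sum_prod_type, hab, Real.negMulLog_mul, Finset.sum_add_distrib,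
    ← Finset.sum_mul, ← Finset.mul_sum, sum_measureReal_preimage μ hX,
    sum_measureReal_preimage μ hY, one_mul]

variable {ι : Type*} [Fintype ι] [DecidableEq ι] {α : ι → Type*} [∀ j, Fintype (α j)]
  [∀ j, MeasurableSpace (α j)] [∀ j, MeasurableSingletonClass (α j)] {X : ∀ j, Ω → α j}

open InformationTheory in
theorem sum_entropy_sub_entropy_eq (hX : ∀ j, Measurable (X j)) :
    (∑ j, entropy μ (X j)) - entropy μ (fun ω j => X j ω) =
      ∑ a : ∀ j, α j, (∏ j, μ.real (X j ⁻¹' {a j})) *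
        klFun (μ.real ((fun ω j => X j ω) ⁻¹' {a}) / ∏ j, μ.real (X j ⁻¹' {a j})) := by
  classical
  have hX' : Measurable fun ω j => X j ω := measurable_pi_lambda _ hX
  refine sum_negMulLog_sub_negMulLog_eq (fun a => μ.real ((fun ω j => X j ω) ⁻¹' {a}))
    (fun j b => μ.real (X j ⁻¹' {b})) (fun _ => measureReal_nonneg)
    (sum_measureReal_preimage μ hX') (fun a j => measureReal_mono ?_) fun j g =>
    sum_measureReal_preimage_mul μ hX' (fun a => a j) g
  intro ω hω
  exact congr_fun hω j

open InformationTheory in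
theorem entropy_le_sum_entropy (hX : ∀ j, Measurable (X j)) :
    0 ≤ (∑ j, entropy μ (X j)) - entropy μ (fun ω j => X j ω) := by
  rw [sum_entropy_sub_entropy_eq μ hX]
  refine Finset.sum_nonneg fun a _ => ?_
  have h : 0 ≤ ∏ j, μ.real (X j ⁻¹' {a j}) := Finset.prod_nonneg fun _ _ => measureReal_nonneg
  exact mul_nonneg h (klFun_nonneg (div_nonneg measureReal_nonneg h))

open InformationTheory in
-- A sum of nonnegative terms vanishes only termwise. At an atom either the ratio of joint mass to
-- product mass is `1`, or some marginal is `0` and then so is the joint mass. Either way the two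
-- laws agree on singletons.
theorem sum_entropy_sub_entropy_eq_zero_iff (hX : ∀ j, Measurable (X j)) :
    (∑ j, entropy μ (X j)) - entropy μ (fun ω j => X j ω) = 0 ↔ iIndepFun X μ := by
  rw [sum_entropy_sub_entropy_eq μ hX, Finset.sum_eq_zero_iff_of_nonneg,
    iIndepFun_iff_map_fun_eq_pi_map fun j => (hX j).aemeasurable]
  · have hX' : Measurable fun ω j => X j ω := measurable_pi_lambda _ hX
    have hsing (a : ∀ j, α j) :
        μ.map (fun ω j => X j ω) {a} = Measure.pi (fun j => μ.map (X j)) {a} ↔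
          μ.real ((fun ω j => X j ω) ⁻¹' {a}) = ∏ j, μ.real (X j ⁻¹' {a j}) := by
      have _ (j : ι) : IsProbabilityMeasure (μ.map (X j)) :=
        Measure.isProbabilityMeasure_map (hX j).aemeasurable
      rw [Measure.pi_singleton, Measure.map_apply hX' (measurableSet_singleton a)]
      simp only [Measure.map_apply (hX _) (measurableSet_singleton _), measureReal_def]
      rw [← ENNReal.toReal_prod, ENNReal.toReal_eq_toReal_iff' (measure_ne_top _ _)]
      exact ENNReal.prod_ne_top fun _ _ => measure_ne_top _ _
    constructor
    · refine fun h => Measure.ext_of_singleton fun a => (hsing a).2 ?_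
      have hle (j : ι) : μ.real ((fun ω j => X j ω) ⁻¹' {a}) ≤ μ.real (X j ⁻¹' {a j}) :=
        measureReal_mono fun ω hω => congr_fun hω j
      rcases mul_eq_zero.1 (h a (Finset.mem_univ a)) with h0 | h1
      · obtain ⟨j, -, hj⟩ := Finset.prod_eq_zero_iff.1 h0
        rw [h0]
        exact le_antisymm (hj ▸ hle j) measureReal_nonneg
      · have hnn : 0 ≤ ∏ j, μ.real (X j ⁻¹' {a j}) :=
          Finset.prod_nonneg fun _ _ => measureReal_nonneg
        exact eq_of_div_eq_one ((klFun_eq_zero_iff (div_nonneg measureReal_nonneg hnn)).1 h1)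
    · intro h a _
      rw [(hsing a).1 (by rw [h])]
      by_cases h0 : ∏ j, μ.real (X j ⁻¹' {a j}) = 0
      · simp [h0]
      · simp [div_self h0, klFun_one]
  · intro a _
    have h : 0 ≤ ∏ j, μ.real (X j ⁻¹' {a j}) := Finset.prod_nonneg fun _ _ => measureReal_nonneg
    exact mul_nonneg h (klFun_nonneg (div_nonneg measureReal_nonneg h))

end Entropy

/-! ### Empirical entropy -/

theorem frequency_nonneg {α : Type*} (T : ℕ) (y : ℕ → α) (p : α → Prop) : 0 ≤ frequency T y p := by
  unfold frequency; positivity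

/-- Equality fails only for `T = 0`, when all frequencies are `0`. -/
theorem sum_frequency_le_one {α : Type*} [Fintype α] (T : ℕ) (y : ℕ → α) :
    ∑ a, frequency T y (fun b => b = a) ≤ 1 := by
  classical
  simp only [frequency]
  rw [← Finset.sum_div, ← Nat.cast_sum]
  have h := Finset.card_eq_sum_card_fiberwise (f := y) (s := Finset.range T) (t := Finset.univ)
    (fun _ _ => by simp)
  rw [Finset.card_range] at h
  refine div_le_one_of_le₀ ?_ (Nat.cast_nonneg _)
  conv_rhs => rw [h]

theorem empEntropy_nonneg {α : Type*} [Fintype α] (T : ℕ) (y : ℕ → α) : 0 ≤ empEntropy T y :=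
  Finset.sum_nonneg fun a _ => Real.negMulLog_nonneg (frequency_nonneg _ _ _)
    ((Finset.single_le_sum (f := fun a => frequency T y fun b => b = a)
      (fun _ _ => frequency_nonneg _ _ _) (Finset.mem_univ a)).trans (sum_frequency_le_one T y))

/-- From `log x ≤ x - 1` at `x = 1 / (c * p)`, summed over the `c` letters. The extra `1` is
harmless, as only the order of growth is needed, and the bound also covers `T = 0`. -/
theorem empEntropy_le {α : Type*} [Fintype α] [Nonempty α] (T : ℕ) (y : ℕ → α) :
    empEntropy T y ≤ Real.log (Fintype.card α) + 1 := by
  set c : ℝ := ((Fintype.card α : ℕ) : ℝ) with hcdef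
  have hc : 1 ≤ c := Nat.one_le_cast.2 Fintype.card_pos
  have hc0 : 0 < c := by linarith
  have hterm {p : ℝ} (hp : 0 ≤ p) : Real.negMulLog p ≤ p * Real.log c + 1 / c := by
    rcases hp.eq_or_lt with rfl | hp
    · simpa using hc0.le
    · have h := Real.log_le_sub_one_of_pos (x := 1 / (c * p)) (by positivity)
      rw [one_div, Real.log_inv, Real.log_mul hc0.ne' hp.ne'] at h
      have h2 := mul_le_mul_of_nonneg_left h hp.le
      have h3 : p * ((c * p)⁻¹ - 1) = 1 / c - p := by field_simp
      rw [h3] at h2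
      rw [Real.negMulLog]
      linarith
  calc empEntropy T y
      ≤ ∑ a, (frequency T y (fun b => b = a) * Real.log c + 1 / c) :=
        Finset.sum_le_sum fun a _ => hterm (frequency_nonneg _ _ _)
    _ = (∑ a, frequency T y (fun b => b = a)) * Real.log c + 1 := by
        rw [Finset.sum_add_distrib, ← Finset.sum_mul, Finset.sum_const, Finset.card_univ,
          nsmul_eq_mul, mul_one_div_cancel hc0.ne']
    _ ≤ _ := by
        have := mul_le_mul_of_nonneg_right (sum_frequency_le_one T y) (Real.log_nonneg hc)
        linarith

/-- Entropy depends only on which outcomes a random variable distinguishes. -/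
theorem entropy_congr_of_eq_iff {Ω : Type*} [MeasurableSpace Ω] (μ : Measure Ω) {α β : Type*}
    [Fintype α] [Fintype β] {X : Ω → α} {Y : Ω → β} (h : ∀ ω ω', X ω = X ω' ↔ Y ω = Y ω') :
    entropy μ X = entropy μ Y := by
  classical
  let Z := Set.rangeFactorization X
  let e : Set.range X → β := fun a => Y a.2.choose
  have hY : Y = fun ω => e (Z ω) := by
    funext ω
    exact (h _ _).1 (Z ω).2.choose_spec.symm
  have he : Function.Injective e := by
    intro a b hab
    have := (h _ _).2 hab
    rwa [a.2.choose_spec, b.2.choose_spec, Subtype.coe_inj] at this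
  calc entropy μ X = entropy μ Z := entropy_comp_of_injective μ Z Subtype.val_injective
    _ = entropy μ Y := by rw [hY, entropy_comp_of_injective μ Z he]

/-! ### Weighted double series -/

theorem weight_nonneg (j : ℕ) : 0 ≤ weight j := by unfold weight; positivity

theorem weight_succ_pos (j : ℕ) : 0 < weight (j + 1) := by unfold weight; positivity

theorem summable_weight : Summable fun l : ℕ => weight (l + 1) := by
  have h := (summable_nat_add_iff 1).2 (Real.summable_one_div_nat_pow.2 one_lt_two)
  refine Summable.of_nonneg_of_le (fun l => weight_nonneg _) (fun l => ?_) h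
  unfold weight
  refine one_div_le_one_div_of_le (by positivity) ?_
  push_cast
  nlinarith [Nat.cast_nonneg (α := ℝ) l]

/-- The double series that defines the sum-information. -/
noncomputable def weightedSum (T : ℕ → ℕ → ℝ) : ℝ :=
  ∑' m : ℕ, 1 / ((m + 1 : ℕ) : ℝ) * weight (m + 1) *
    ∑' l : ℕ, 1 / ((l + 1 : ℕ) : ℝ) * weight (l + 1) * T (m + 1) (l + 1)

section WeightedSum

variable {T : ℕ → ℕ → ℝ} {K : ℝ}

/-- The factor `1 / (l + 1)` cancels linear growth in `l`, which leaves a summable bound independent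
of `m`. -/
theorem abs_inner_le (hT : ∀ m l, |T m (l + 1)| ≤ K * (l + 1 : ℕ)) (m l : ℕ) :
    ‖1 / ((l + 1 : ℕ) : ℝ) * weight (l + 1) * T m (l + 1)‖ ≤ weight (l + 1) * K := by
  have hl : (0 : ℝ) < (l + 1 : ℕ) := by positivity
  rw [norm_mul, Real.norm_eq_abs, Real.norm_eq_abs,
    abs_of_nonneg (mul_nonneg (by positivity) (weight_nonneg _))]
  calc _ ≤ 1 / ((l + 1 : ℕ) : ℝ) * weight (l + 1) * (K * (l + 1 : ℕ)) :=
        mul_le_mul_of_nonneg_left (hT m l) (mul_nonneg (by positivity) (weight_nonneg _))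
    _ = weight (l + 1) * K := by field_simp

theorem summable_inner (hT : ∀ m l, |T m (l + 1)| ≤ K * (l + 1 : ℕ)) (m : ℕ) :
    Summable fun l : ℕ => 1 / ((l + 1 : ℕ) : ℝ) * weight (l + 1) * T m (l + 1) :=
  Summable.of_norm_bounded (summable_weight.mul_right K) (abs_inner_le hT m)

theorem abs_outer_le (hT : ∀ m l, |T m (l + 1)| ≤ K * (l + 1 : ℕ)) (m : ℕ) :
    ‖1 / ((m + 1 : ℕ) : ℝ) * weight (m + 1) *
      ∑' l : ℕ, 1 / ((l + 1 : ℕ) : ℝ) * weight (l + 1) * T (m + 1) (l + 1)‖ ≤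
      weight (m + 1) * ∑' l : ℕ, weight (l + 1) * K := by
  have h := tsum_of_norm_bounded (summable_weight.mul_right K).hasSum (abs_inner_le hT (m + 1))
  have h1 : 1 / ((m + 1 : ℕ) : ℝ) ≤ 1 := div_le_one_of_le₀ (by norm_num) (by positivity)
  rw [norm_mul, Real.norm_eq_abs (1 / _ * _),
    abs_of_nonneg (mul_nonneg (by positivity) (weight_nonneg _))]
  exact mul_le_mul (mul_le_of_le_one_left (weight_nonneg _) h1) h (norm_nonneg _)
    (weight_nonneg _)

/-- Dominated convergence, applied to the outer and to the inner series. -/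
theorem tendsto_weightedSum {T : ℕ → ℕ → ℕ → ℝ} {T' : ℕ → ℕ → ℝ}
    (hT : ∀ n m l, |T n m (l + 1)| ≤ K * (l + 1 : ℕ))
    (h : ∀ m l, Tendsto (fun n => T n m l) atTop (𝓝 (T' m l))) :
    Tendsto (fun n => weightedSum (T n)) atTop (𝓝 (weightedSum T')) := by
  refine tendsto_tsum_of_dominated_convergence
    (summable_weight.mul_right (∑' l : ℕ, weight (l + 1) * K)) (fun m => ?_)
    (Eventually.of_forall fun n m => abs_outer_le (hT n) m)
  refine Tendsto.const_mul _ ?_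
  refine tendsto_tsum_of_dominated_convergence (summable_weight.mul_right K) (fun l => ?_)
    (Eventually.of_forall fun n l => abs_inner_le (hT n) (m + 1) l)
  exact (h _ _).const_mul _

theorem weightedSum_nonneg (h0 : ∀ m l, 0 ≤ T m l) : 0 ≤ weightedSum T :=
  tsum_nonneg fun _ => mul_nonneg (mul_nonneg (by positivity) (weight_nonneg _))
    (tsum_nonneg fun _ => mul_nonneg (mul_nonneg (by positivity) (weight_nonneg _)) (h0 _ _))

/-- The growth bound is what makes this true: a series that is not summable would have sum `0` by
default. -/
theorem weightedSum_eq_zero_iff (hT : ∀ m l, |T m (l + 1)| ≤ K * (l + 1 : ℕ))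
    (h0 : ∀ m l, 0 ≤ T m l) : weightedSum T = 0 ↔ ∀ m l, T (m + 1) (l + 1) = 0 := by
  have hw (j : ℕ) : 1 / ((j + 1 : ℕ) : ℝ) * weight (j + 1) ≠ 0 :=
    mul_ne_zero (by positivity) (weight_succ_pos j).ne'
  have hin (m l : ℕ) : 0 ≤ 1 / ((l + 1 : ℕ) : ℝ) * weight (l + 1) * T (m + 1) (l + 1) :=
    mul_nonneg (mul_nonneg (by positivity) (weight_nonneg _)) (h0 _ _)
  have hout : Summable fun m : ℕ => 1 / ((m + 1 : ℕ) : ℝ) * weight (m + 1) *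
      ∑' l : ℕ, 1 / ((l + 1 : ℕ) : ℝ) * weight (l + 1) * T (m + 1) (l + 1) :=
    Summable.of_norm_bounded (summable_weight.mul_right _) (abs_outer_le hT)
  rw [weightedSum, ← hout.hasSum_iff, hasSum_zero_iff_of_nonneg fun m =>
    mul_nonneg (mul_nonneg (by positivity) (weight_nonneg _)) (tsum_nonneg (hin m)), funext_iff]
  refine forall_congr' fun m => ?_
  rw [Pi.zero_apply, mul_eq_zero, or_iff_right (hw m), ← (summable_inner hT (m + 1)).hasSum_iff,
    hasSum_zero_iff_of_nonneg (hin m), funext_iff]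
  refine forall_congr' fun l => ?_
  rw [Pi.zero_apply, mul_eq_zero, or_iff_right (hw l)]

end WeightedSum

/-! ### The sum-information of a process distribution -/

section SumInfo

variable {N : ℕ} (B : QuantizerFamily) (ρ : Measure (ℕ → Fin N → ℝ))

theorem quantizedBlock_eq_iff {x y : ℕ → Fin N → ℝ} {m l t s : ℕ} {A : Finset (Fin N)} :
    quantizedBlock B x m l A t = quantizedBlock B y m l A s ↔
      ∀ i ∈ A, B.cell m l (fun j : Fin m => x (t + j) i) = B.cell m l (fun j => y (s + j) i) := by
  simp [quantizedBlock, funext_iff]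

/-- Jointly quantized blocks of the groups in `U`. -/
def jointBlock (x : ℕ → Fin N → ℝ) (m l : ℕ) (U : List (Finset (Fin N))) (t : ℕ) :
    ∀ j : Fin U.length, {i // i ∈ U.get j} → Fin (2 ^ l) :=
  fun j => quantizedBlock B x m l (U.get j) t

theorem jointBlock_eq_iff {x y : ℕ → Fin N → ℝ} {m l t s : ℕ} {U : List (Finset (Fin N))} :
    jointBlock B x m l U t = jointBlock B y m l U s ↔
      ∀ A ∈ U, ∀ i ∈ A,
        B.cell m l (fun j : Fin m => x (t + j) i) = B.cell m l (fun j => y (s + j) i) := by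
  simp only [jointBlock, funext_iff (f := fun j : Fin U.length => _), quantizedBlock_eq_iff]
  exact ⟨fun h A hA => by obtain ⟨j, rfl⟩ := List.mem_iff_get.1 hA; exact h j,
    fun h j => h _ (List.get_mem _ _)⟩

/-- The mutual information of the groups in `U`, for quantized blocks of length `m`. -/
noncomputable def infoTerm (U : List (Finset (Fin N))) (m l : ℕ) : ℝ :=
  (∑ j : Fin U.length, entropy ρ (fun x => quantizedBlock B x m l (U.get j) 0)) -
    entropy ρ (fun x => jointBlock B x m l U 0)

/-- The sum-information of the groups in `U` under the process distribution. -/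
noncomputable def sumInfo (U : List (Finset (Fin N))) : ℝ := weightedSum (infoTerm B ρ U)

variable {ρ} in
-- Entropy is a finite sum of a function of frequencies that is continuous even at `0`, and the
-- frequencies converge by ergodicity on the fibres of `f`.
theorem IsStationaryErgodic.tendsto_empEntropy (h : IsStationaryErgodic ρ) {m : ℕ} {α : Type*}
    [Fintype α] [MeasurableSpace α] [MeasurableSingletonClass α]
    {f : (Fin m → Fin N → ℝ) → α} (hf : Measurable f) :
    ∀ᵐ x ∂ρ, Tendsto (fun n => empEntropy (windowCount n m) fun t => f (block x m t)) atTop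
      (𝓝 (entropy ρ fun x => f (block x m 0))) := by
  have key : ∀ᵐ x ∂ρ, ∀ a, Tendsto (fun n => frequency (windowCount n m) (block x m)
      (fun b => b ∈ f ⁻¹' {a})) atTop (𝓝 (ρ.real {y | block y m 0 ∈ f ⁻¹' {a}})) :=
    ae_all_iff.2 fun a => h.frequencies m _ (hf (measurableSet_singleton a))
  filter_upwards [key] with x hx
  exact tendsto_finsetSum _ fun a _ => (Real.continuous_negMulLog.tendsto _).comp (hx a)

/-- The indices of the cells that contain the blocks of the series in `A`. -/
def blockCells (m l : ℕ) (A : Finset (Fin N)) (b : Fin m → Fin N → ℝ) :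
    {i // i ∈ A} → Fin (2 ^ l) :=
  fun i => B.cell m l (fun j => b j i.1)

theorem measurable_blockCells (m l : ℕ) (A : Finset (Fin N)) : Measurable (blockCells B m l A) :=
  measurable_pi_lambda _ fun i => (B.measurable_cell m l).comp (by fun_prop)

theorem quantizedBlock_eq_blockCells (x : ℕ → Fin N → ℝ) (m l : ℕ) (A : Finset (Fin N)) (t : ℕ) :
    quantizedBlock B x m l A t = blockCells B m l A (block x m t) := rfl

/-- Joint version of `blockCells` for the groups in `U`. -/
def jointCells (m l : ℕ) (U : List (Finset (Fin N))) (b : Fin m → Fin N → ℝ) :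
    ∀ j : Fin U.length, {i // i ∈ U.get j} → Fin (2 ^ l) :=
  fun j => blockCells B m l (U.get j) b

theorem jointBlock_eq_jointCells (x : ℕ → Fin N → ℝ) (m l : ℕ) (U : List (Finset (Fin N)))
    (t : ℕ) : jointBlock B x m l U t = jointCells B m l U (block x m t) := rfl

theorem measurable_jointCells (m l : ℕ) (U : List (Finset (Fin N))) :
    Measurable (jointCells B m l U) :=
  measurable_pi_lambda _ fun j => measurable_blockCells B m l (U.get j)

variable {ρ} in
theorem IsStationaryErgodic.tendsto_empInfoTerm (h : IsStationaryErgodic ρ)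
    (U : List (Finset (Fin N))) (m l : ℕ) :
    ∀ᵐ x ∂ρ, Tendsto (fun n => empInfoTerm B n x U m l) atTop (𝓝 (infoTerm B ρ U m l)) := by
  have h1 : ∀ᵐ x ∂ρ, ∀ j : Fin U.length, Tendsto (fun n => empEntropy (windowCount n m)
      fun t => quantizedBlock B x m l (U.get j) t) atTop
      (𝓝 (entropy ρ fun x => quantizedBlock B x m l (U.get j) 0)) := by
    simp only [quantizedBlock_eq_blockCells]
    exact ae_all_iff.2 fun j => h.tendsto_empEntropy (measurable_blockCells B m l (U.get j))
  have h2 : ∀ᵐ x ∂ρ, Tendsto (fun n => empEntropy (windowCount n m)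
      fun t => jointBlock B x m l U t) atTop (𝓝 (entropy ρ fun x => jointBlock B x m l U 0)) := by
    simp only [jointBlock_eq_jointCells]
    exact h.tendsto_empEntropy (measurable_jointCells B m l U)
  filter_upwards [h1, h2] with x hx1 hx2
  exact (tendsto_finsetSum _ fun j _ => hx1 j).sub hx2

theorem exists_abs_empInfoTerm_le (U : List (Finset (Fin N))) :
    ∃ K : ℝ, ∀ n (x : ℕ → Fin N → ℝ) m l, |empInfoTerm B n x U m (l + 1)| ≤ K * (l + 1 : ℕ) := by
  set a : Fin U.length → ℝ := fun j => ((U.get j).card : ℝ) * Real.log 2 with ha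
  have ha0 (j) : 0 ≤ a j := mul_nonneg (Nat.cast_nonneg _) (Real.log_nonneg one_le_two)
  refine ⟨(∑ j, (a j + 1)) + ((∑ j, a j) + 1), fun n x m l => ?_⟩
  -- Since `l + 1 ≥ 1`, the additive `1` of `empEntropy_le` is absorbed into the multiple of `l +
  -- 1`.
  have hl : (1 : ℝ) ≤ (l + 1 : ℕ) := by simp
  have h1 : ∑ j, empEntropy (windowCount n m) (fun t => quantizedBlock B x m (l + 1) (U.get j) t) ≤
      (∑ j, (a j + 1)) * (l + 1 : ℕ) := by
    rw [Finset.sum_mul]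
    refine Finset.sum_le_sum fun j _ => (empEntropy_le _ _).trans ?_
    have : Real.log (Fintype.card ({i // i ∈ U.get j} → Fin (2 ^ (l + 1)))) =
        a j * (l + 1 : ℕ) := by
      simp [ha]; ring
    rw [this]
    linarith
  have h2 : empEntropy (windowCount n m) (fun t => jointBlock B x m (l + 1) U t) ≤
      ((∑ j, a j) + 1) * (l + 1 : ℕ) := by
    refine (empEntropy_le _ _).trans ?_
    have : Real.log (Fintype.card (∀ j : Fin U.length, {i // i ∈ U.get j} → Fin (2 ^ (l + 1)))) =
        (∑ j, a j) * (l + 1 : ℕ) := by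
      rw [Fintype.card_pi, Nat.cast_prod, Real.log_prod fun j _ => by simp, Finset.sum_mul]
      refine Finset.sum_congr rfl fun j _ => ?_
      simp [ha]; ring
    rw [this]
    linarith
  have h3 : 0 ≤ ∑ j, empEntropy (windowCount n m)
      (fun t => quantizedBlock B x m (l + 1) (U.get j) t) :=
    Finset.sum_nonneg fun _ _ => empEntropy_nonneg _ _
  have h4 := empEntropy_nonneg (windowCount n m) fun t => jointBlock B x m (l + 1) U t
  have h5 : empInfoTerm B n x U m (l + 1) = (∑ j, empEntropy (windowCount n m)
      (fun t => quantizedBlock B x m (l + 1) (U.get j) t)) -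
      empEntropy (windowCount n m) fun t => jointBlock B x m (l + 1) U t := rfl
  rw [h5, abs_le, add_mul]
  constructor <;> linarith

variable {ρ} in
-- There are countably many triples `U`, `m`, `l`, so one null set serves all of them.
theorem IsStationaryErgodic.tendsto_empSumInfo (h : IsStationaryErgodic ρ) :
    ∀ᵐ x ∂ρ, ∀ U, Tendsto (fun n => empSumInfo B n x U) atTop (𝓝 (sumInfo B ρ U)) := by
  refine ae_all_iff.2 fun U => ?_
  obtain ⟨K, hK⟩ := exists_abs_empInfoTerm_le B U
  have key : ∀ᵐ x ∂ρ, ∀ m l, Tendsto (fun n => empInfoTerm B n x U m l) atTop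
      (𝓝 (infoTerm B ρ U m l)) :=
    ae_all_iff.2 fun m => ae_all_iff.2 fun l => h.tendsto_empInfoTerm B U m l
  filter_upwards [key] with x hx
  exact tendsto_weightedSum (fun n => hK n x) hx

variable {ρ} in
-- The bound is inherited from the empirical terms along any one path on which they converge.
theorem IsStationaryErgodic.exists_abs_infoTerm_le [IsProbabilityMeasure ρ]
    (h : IsStationaryErgodic ρ) (U : List (Finset (Fin N))) :
    ∃ K : ℝ, ∀ m l, |infoTerm B ρ U m (l + 1)| ≤ K * (l + 1 : ℕ) := by
  obtain ⟨K, hK⟩ := exists_abs_empInfoTerm_le B U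
  refine ⟨K, fun m l => ?_⟩
  obtain ⟨x, hx⟩ := (h.tendsto_empInfoTerm B U m (l + 1)).exists
  exact le_of_tendsto' hx.abs fun n => hK n x m l

end SumInfo

/-! ### Independence of families of sigma-algebras -/

section Indep

variable {Ω ι κ : Type*} {mΩ : MeasurableSpace Ω} {μ : Measure Ω}

theorem iIndep.mono {m m' : ι → MeasurableSpace Ω} (h : iIndep m μ) (hle : ∀ i, m' i ≤ m i) :
    iIndep m' μ := by
  rw [iIndep_iff] at h ⊢
  exact fun s f hf => h s fun i hi => hle i _ (hf i hi)

theorem iIndep_of_forall_iInter [Fintype ι] [IsProbabilityMeasure μ] {m : ι → MeasurableSpace Ω}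
    (h : ∀ f : ι → Set Ω, (∀ i, MeasurableSet[m i] (f i)) → μ (⋂ i, f i) = ∏ i, μ (f i)) :
    iIndep m μ := by
  classical
  rw [iIndep_iff]
  intro s f hf
  have h1 := h (fun i => if i ∈ s then f i else Set.univ) fun i => by
    split_ifs with hi
    exacts [hf i hi, MeasurableSet.univ]
  have h2 : ⋂ i, (if i ∈ s then f i else Set.univ) = ⋂ i ∈ s, f i := by
    ext ω
    simp only [Set.mem_iInter]
    refine forall_congr' fun i => ?_
    split_ifs with hi <;> simp [hi]
  rw [← h2, h1, ← Finset.prod_subset (Finset.subset_univ s) fun i _ hi => by simp [hi]]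
  exact Finset.prod_congr rfl fun i hi => by simp [hi]

/-- Independent sigma-algebras, each of which contains an independent family, yield an independent
family altogether. -/
theorem iIndep.prod_of_le [Fintype ι] [Fintype κ] [IsProbabilityMeasure μ]
    {m : ι → MeasurableSpace Ω} {m' : ι → κ → MeasurableSpace Ω} (h : iIndep m μ)
    (hle : ∀ i j, m' i j ≤ m i) (h' : ∀ i, iIndep (m' i) μ) :
    iIndep (fun p : ι × κ => m' p.1 p.2) μ := by
  refine iIndep_of_forall_iInter fun f hf => ?_
  have h1 : ⋂ p, f p = ⋂ i, ⋂ j, f (i, j) := by ext ω; simp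
  rw [h1, h.meas_iInter fun i => MeasurableSet.iInter fun j => hle i j _ (hf (i, j)),
    Fintype.prod_prod_type]
  exact Finset.prod_congr rfl fun i _ => (h' i).meas_iInter fun j => hf (i, j)

/-- By monotonicity the union over `n` is a π-system that generates the supremum, and finitely many
events from such unions already lie in a common level. -/
theorem iIndep_iSup_of_monotone [Finite ι] {m : ℕ → ι → MeasurableSpace Ω}
    (hmono : ∀ i, Monotone fun n => m n i) (hle : ∀ n i, m n i ≤ mΩ) (h : ∀ n, iIndep (m n) μ) :
    iIndep (fun i => ⨆ n, m n i) μ := by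
  have := Fintype.ofFinite ι
  refine iIndepSets.iIndep (fun i => iSup_le fun n => hle n i)
    (fun i => ⋃ n, {s | MeasurableSet[m n i] s})
    (fun i => isPiSystem_iUnion_of_monotone _ (fun n => @MeasurableSpace.isPiSystem_measurableSet _ (m n i))
      fun a b hab s hs => hmono i hab s hs)
    (fun i => (MeasurableSpace.generateFrom_iUnion_measurableSet _).symm) ?_
  rw [iIndepSets_iff]
  intro s f hf
  simp only [Set.mem_iUnion] at hf
  choose! k hk using hf
  refine (h (s.sup k)).meas_biInter fun i hi => hmono i (Finset.le_sup hi) _ (hk i hi)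

end Indep

/-! ### The sigma-algebras of groups of series -/

section SeriesSigma

variable {N : ℕ}

theorem measurable_pi_of_forall {Ω δ : Type*} {X : δ → Type*} {mΩ : MeasurableSpace Ω}
    [∀ a, MeasurableSpace (X a)] {f : Ω → ∀ a, X a} (hf : ∀ a, Measurable fun ω => f ω a) :
    Measurable f :=
  measurable_pi_lambda f hf

/-- The sigma-algebra generated by the series with index in `A`. -/
@[reducible] def seriesSigma (A : Finset (Fin N)) : MeasurableSpace (ℕ → Fin N → ℝ) :=
  MeasurableSpace.comap (fun x (i : {i // i ∈ A}) (t : ℕ) => x t i.1) inferInstance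

theorem seriesSigma_le (A : Finset (Fin N)) : seriesSigma A ≤ MeasurableSpace.pi :=
  Measurable.comap_le (by fun_prop)

theorem measurable_seriesSigma {A : Finset (Fin N)} {i : Fin N} (hi : i ∈ A) (t : ℕ) :
    Measurable[seriesSigma A] fun x : ℕ → Fin N → ℝ => x t i := by
  have h1 : Measurable[seriesSigma A] fun (x : ℕ → Fin N → ℝ) (i : {i // i ∈ A}) (t : ℕ) => x t i.1 :=
    comap_measurable _
  have h2 : Measurable fun y : {i // i ∈ A} → ℕ → ℝ => y ⟨i, hi⟩ t := by fun_prop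
  exact h2.comp h1

theorem seriesSigma_mono {A A' : Finset (Fin N)} (h : A ⊆ A') :
    seriesSigma A ≤ seriesSigma A' :=
  Measurable.comap_le (measurable_pi_of_forall fun i => measurable_pi_of_forall fun t =>
    measurable_seriesSigma (h i.2) t)

theorem seriesSigma_empty : seriesSigma (∅ : Finset (Fin N)) = ⊥ := by
  have : Subsingleton ({i // i ∈ (∅ : Finset (Fin N))} → ℕ → ℝ) :=
    ⟨fun f g => funext fun i => absurd i.2 (Finset.notMem_empty _)⟩
  refine le_bot_iff.1 ?_
  rintro s ⟨t, -, rfl⟩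
  rcases Set.eq_empty_or_nonempty t with rfl | ⟨y, hy⟩
  · simp
  · rw [Set.eq_univ_of_forall (s := t) fun z => Subsingleton.elim y z ▸ hy]
    simp

variable (B : QuantizerFamily)

theorem measurable_quantizedBlock {A A' : Finset (Fin N)} (h : A ⊆ A') (m l t : ℕ) :
    Measurable[seriesSigma A'] fun x => quantizedBlock B x m l A t :=
  measurable_pi_of_forall fun i => (B.measurable_cell m l).comp
    (measurable_pi_of_forall fun j => measurable_seriesSigma (h i.2) (t + j))

theorem measurable_jointBlock {U : List (Finset (Fin N))} {A' : Finset (Fin N)}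
    (h : ∀ A ∈ U, A ⊆ A') (m l t : ℕ) :
    Measurable[seriesSigma A'] fun x => jointBlock B x m l U t :=
  measurable_pi_of_forall fun _ => measurable_quantizedBlock B (h _ (List.get_mem _ _)) m l t

/-- The sigma-algebra generated by the quantized initial blocks of the series in `A`. -/
@[reducible] def quantizedSigma (m l : ℕ) (A : Finset (Fin N)) : MeasurableSpace (ℕ → Fin N → ℝ) :=
  MeasurableSpace.comap (fun x => quantizedBlock B x m l A 0) inferInstance

/-- The sigma-algebra generated by the first `m` values of the series in `A`. -/
@[reducible] def initialSigma (m : ℕ) (A : Finset (Fin N)) : MeasurableSpace (ℕ → Fin N → ℝ) :=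
  ⨆ i : {i // i ∈ A}, ⨆ j : Fin m, MeasurableSpace.comap (fun x => x j i.1) inferInstance

theorem initialSigma_mono (A : Finset (Fin N)) : Monotone fun m => initialSigma m A :=
  fun _ b hab => iSup_mono fun i => iSup_le fun j =>
    le_iSup (fun (j : Fin b) => MeasurableSpace.comap (fun x : ℕ → Fin N → ℝ => x j i.1) inferInstance)
      (Fin.castLE hab j)

theorem initialSigma_le (m : ℕ) (A : Finset (Fin N)) : initialSigma m A ≤ MeasurableSpace.pi :=
  iSup_le fun _ => iSup_le fun _ => Measurable.comap_le (by fun_prop)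

theorem seriesSigma_le_iSup_initialSigma (A : Finset (Fin N)) :
    seriesSigma A ≤ ⨆ m, initialSigma (m + 1) A := by
  refine Measurable.comap_le (measurable_pi_of_forall fun i => measurable_pi_of_forall fun t => ?_)
  refine Measurable.of_comap_le ?_
  refine le_trans ?_ (le_iSup (fun m => initialSigma (m + 1) A) t)
  exact (le_iSup (fun j : Fin (t + 1) =>
    MeasurableSpace.comap (fun x : ℕ → Fin N → ℝ => x j i.1) inferInstance) (Fin.last t)).trans
    (le_iSup (fun i : {i // i ∈ A} => ⨆ j : Fin (t + 1),
      MeasurableSpace.comap (fun x : ℕ → Fin N → ℝ => x j i.1) inferInstance) i)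

theorem quantizedSigma_le (m l : ℕ) (A : Finset (Fin N)) :
    quantizedSigma B m l A ≤ MeasurableSpace.pi :=
  (measurable_quantizedBlock B subset_rfl m l 0).comap_le.trans (seriesSigma_le A)

theorem comap_le_comap_of_factors {Ω α β : Type*} [MeasurableSpace α] [MeasurableSpace β]
    [DiscreteMeasurableSpace β] {f : Ω → α} {g : Ω → β} (h : ∀ ω ω', g ω = g ω' → f ω = f ω') :
    MeasurableSpace.comap f inferInstance ≤ MeasurableSpace.comap g inferInstance := by
  rintro _ ⟨t, -, rfl⟩
  refine ⟨g '' (f ⁻¹' t), MeasurableSet.of_discrete, ?_⟩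
  ext ω
  constructor
  · rintro ⟨ω', h', hg⟩
    rwa [Set.mem_preimage, ← h _ _ hg]
  · exact fun hω => ⟨ω, hω, rfl⟩

theorem quantizedSigma_mono (m : ℕ) (A : Finset (Fin N)) :
    Monotone fun l => quantizedSigma B m l A := by
  refine monotone_nat_of_le_succ fun l => comap_le_comap_of_factors fun x y hxy => ?_
  rw [quantizedBlock_eq_iff] at hxy ⊢
  exact fun i hi => B.refines _ _ _ _ (hxy i hi)

theorem initialSigma_le_iSup_quantizedSigma (m : ℕ) (A : Finset (Fin N)) :
    initialSigma m A ≤ ⨆ l, quantizedSigma B m (l + 1) A := by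
  refine iSup_le fun i => iSup_le fun j => ?_
  have h1 : MeasurableSpace.comap (fun x : ℕ → Fin N → ℝ => x j i.1) inferInstance ≤
      MeasurableSpace.comap (fun (x : ℕ → Fin N → ℝ) (j : Fin m) => x j i.1)
        MeasurableSpace.pi := by
    have : Measurable[MeasurableSpace.comap (fun (x : ℕ → Fin N → ℝ) (j : Fin m) => x j i.1)
        MeasurableSpace.pi] fun (x : ℕ → Fin N → ℝ) (j : Fin m) => x j i.1 := comap_measurable _
    exact ((measurable_pi_apply j).comp this).comap_le
  refine h1.trans ?_
  rw [← B.generates m, MeasurableSpace.comap_iSup]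
  refine iSup_le fun l => le_trans ?_ (le_iSup (fun l => quantizedSigma B m (l + 1) A) l)
  -- Level `0`, which the sum-information omits, is dispensable because level `1` refines it.
  refine le_trans ?_ (quantizedSigma_mono B m A (Nat.le_succ l))
  rw [MeasurableSpace.comap_comp]
  refine Measurable.comap_le ?_
  have h2 : Measurable[quantizedSigma B m l A] fun x => quantizedBlock B x m l A 0 :=
    comap_measurable _
  have h3 := (measurable_pi_apply i).comp h2
  simpa only [quantizedBlock, Function.comp_def, zero_add] using h3

theorem infoTerm_pair {ρ : Measure (ℕ → Fin N → ℝ)} (C R : Finset (Fin N)) (m l : ℕ) :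
    infoTerm B ρ [C, R] m l = entropy ρ (fun x => quantizedBlock B x m l C 0) +
      entropy ρ (fun x => quantizedBlock B x m l R 0) -
      entropy ρ (fun x => jointBlock B x m l [C, R] 0) :=
  congrArg (· - _) (Fin.sum_univ_two (f := fun j : Fin 2 =>
    entropy ρ fun x => quantizedBlock B x m l ([C, R].get j) 0))

variable (ρ : Measure (ℕ → Fin N → ℝ)) [IsProbabilityMeasure ρ]

/-- Independence passes through two increasing limits: `l → ∞` for fixed `m` recovers the
real-valued blocks, then `m → ∞` the whole series. The order matters, as quantizers for different
`m` are unrelated. -/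
theorem forall_infoTerm_eq_zero_iff (U : List (Finset (Fin N))) :
    (∀ m l, infoTerm B ρ U (m + 1) (l + 1) = 0) ↔
      iIndep (fun j : Fin U.length => seriesSigma (U.get j)) ρ := by
  have h1 (m l : ℕ) : infoTerm B ρ U m l = 0 ↔
      iIndep (fun j : Fin U.length => quantizedSigma B m l (U.get j)) ρ :=
    (sum_entropy_sub_entropy_eq_zero_iff ρ fun j =>
      (measurable_quantizedBlock B subset_rfl m l 0).mono (seriesSigma_le (U.get j)) le_rfl).trans
      (iIndepFun_iff_iIndep _ _ _)
  simp only [h1]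
  constructor
  · intro h
    have h2 (m : ℕ) : iIndep (fun j : Fin U.length => initialSigma (m + 1) (U.get j)) ρ :=
      iIndep.mono (iIndep_iSup_of_monotone
        (fun j _ _ hab => quantizedSigma_mono B (m + 1) (U.get j) (Nat.succ_le_succ hab))
        (fun l j => quantizedSigma_le B _ _ _) (h m))
        fun j => initialSigma_le_iSup_quantizedSigma B _ _
    exact iIndep.mono (iIndep_iSup_of_monotone
      (fun j a b hab => initialSigma_mono (U.get j) (Nat.succ_le_succ hab))
      (fun m j => initialSigma_le _ _) h2) fun j => seriesSigma_le_iSup_initialSigma _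
  · exact fun h m l => iIndep.mono h fun j => (measurable_quantizedBlock B subset_rfl _ _ 0).comap_le

theorem infoTerm_nonneg (U : List (Finset (Fin N))) (m l : ℕ) : 0 ≤ infoTerm B ρ U m l :=
  entropy_le_sum_entropy ρ fun j =>
    (measurable_quantizedBlock B subset_rfl m l 0).mono (seriesSigma_le (U.get j)) le_rfl

theorem sumInfo_nonneg (U : List (Finset (Fin N))) : 0 ≤ sumInfo B ρ U :=
  weightedSum_nonneg (infoTerm_nonneg B ρ U)

variable {ρ}

theorem IsStationaryErgodic.sumInfo_eq_zero_iff (h : IsStationaryErgodic ρ)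
    (U : List (Finset (Fin N))) :
    sumInfo B ρ U = 0 ↔ iIndep (fun j : Fin U.length => seriesSigma (U.get j)) ρ := by
  obtain ⟨K, hK⟩ := h.exists_abs_infoTerm_le B U
  rw [sumInfo, weightedSum_eq_zero_iff hK (infoTerm_nonneg B ρ U), forall_infoTerm_eq_zero_iff]

theorem IsStationaryErgodic.indep_of_sumInfo_pair_eq_zero (h : IsStationaryErgodic ρ)
    {C R : Finset (Fin N)} (h0 : sumInfo B ρ [C, R] = 0) :
    Indep (seriesSigma C) (seriesSigma R) ρ :=
  ((h.sumInfo_eq_zero_iff B _).1 h0).indep (i := (0 : Fin 2)) (j := (1 : Fin 2))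
    (show (0 : Fin 2) ≠ 1 by decide)

/-- The empty tuple takes a single value, so it has entropy `0` and adds nothing to a joint entropy.
-/
theorem sumInfo_pair_empty (C : Finset (Fin N)) : sumInfo B ρ [C, ∅] = 0 := by
  have h0 (m l : ℕ) : infoTerm B ρ [C, ∅] m l = 0 := by
    rw [infoTerm_pair,
      entropy_congr_of_eq_iff ρ (X := fun x => quantizedBlock B x m l ∅ 0) (Y := fun _ => ())
        (by simp [quantizedBlock_eq_iff]),
      entropy_congr_of_eq_iff ρ (X := fun x => jointBlock B x m l [C, ∅] 0)
        (Y := fun x => quantizedBlock B x m l C 0)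
        fun x y => by rw [jointBlock_eq_iff, quantizedBlock_eq_iff]; simp]
    simp [entropy]
  simp [sumInfo, weightedSum, h0]

/-- Series outside a group `G ⊇ C` that is independent of its complement do not contribute to the
information about `C`. -/
theorem sumInfo_pair_inter {C G : Finset (Fin N)} (hCG : C ⊆ G)
    (h : Indep (seriesSigma G) (seriesSigma Gᶜ) ρ) (R : Finset (Fin N)) :
    sumInfo B ρ [C, R] = sumInfo B ρ [C, R ∩ G] := by
  unfold sumInfo
  congr 1
  funext m l
  have hc : R \ G ⊆ Gᶜ := fun i hi => Finset.mem_compl.2 (Finset.mem_sdiff.1 hi).2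
  have hV := measurable_quantizedBlock B hc m l 0
  have hsplit {p : Fin N → Prop} : (∀ i ∈ R, p i) ↔ (∀ i ∈ R ∩ G, p i) ∧ ∀ i ∈ R \ G, p i := by
    simp only [Finset.mem_inter, Finset.mem_sdiff]
    exact ⟨fun h => ⟨fun i hi => h i hi.1, fun i hi => h i hi.1⟩,
      fun h i hi => if hG : i ∈ G then h.1 i ⟨hi, hG⟩ else h.2 i ⟨hi, hG⟩⟩
  -- By independence the entropy of the part of `R` outside `G` splits off additively, both from the
  -- entropy of `R` and from the joint entropy with `C`; the two contributions cancel.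
  have h1 : entropy ρ (fun x => quantizedBlock B x m l R 0) =
      entropy ρ (fun x => quantizedBlock B x m l (R ∩ G) 0) +
        entropy ρ (fun x => quantizedBlock B x m l (R \ G) 0) := by
    have hW := measurable_quantizedBlock B (Finset.inter_subset_right (s₁ := R) (s₂ := G)) m l 0
    rw [← entropy_prod ρ (hW.mono (seriesSigma_le _) le_rfl) (hV.mono (seriesSigma_le _) le_rfl)
      ((IndepFun_iff_Indep _ _ _).2 (indep_of_indep_of_le_left
        (indep_of_indep_of_le_right h hV.comap_le) hW.comap_le))]
    refine entropy_congr_of_eq_iff ρ fun x y => ?_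
    simp only [Prod.mk.injEq, quantizedBlock_eq_iff]
    exact hsplit
  have h2 : entropy ρ (fun x => jointBlock B x m l [C, R] 0) =
      entropy ρ (fun x => jointBlock B x m l [C, R ∩ G] 0) +
        entropy ρ (fun x => quantizedBlock B x m l (R \ G) 0) := by
    have hW := measurable_jointBlock B (U := [C, R ∩ G]) (A' := G)
      (by simp [hCG, Finset.inter_subset_right]) m l 0
    rw [← entropy_prod ρ (hW.mono (seriesSigma_le _) le_rfl) (hV.mono (seriesSigma_le _) le_rfl)
      ((IndepFun_iff_Indep _ _ _).2 (indep_of_indep_of_le_left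
        (indep_of_indep_of_le_right h hV.comap_le) hW.comap_le))]
    refine entropy_congr_of_eq_iff ρ fun x y => ?_
    simp only [Prod.mk.injEq, quantizedBlock_eq_iff, jointBlock_eq_iff, List.forall_mem_cons,
      List.not_mem_nil, false_imp_iff, implies_true, and_true, and_assoc]
    exact and_congr_right fun _ => hsplit
  rw [infoTerm_pair, infoTerm_pair, h1, h2]
  ring

end SeriesSigma

/-! ### The ground-truth clustering -/

section GroundTruth

variable {N : ℕ}

/-- Sending each part of `U` to the part of `W` containing it is surjective, hence injective by
cardinality, so no part of `W` contains two parts of `U`. -/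
theorem Finpartition.eq_of_le_of_card_eq {α : Type*} [DecidableEq α] {s : Finset α}
    {U W : Finpartition s} (h : U ≤ W) (hcard : U.parts.card = W.parts.card) : W = U := by
  have h' : ∀ G ∈ U.parts, ∃ A ∈ W.parts, G ⊆ A := fun G hG => h hG
  choose! f hf hsub using h'
  have hsurj : Set.SurjOn f U.parts W.parts := by
    intro A hA
    obtain ⟨i, hi⟩ := W.nonempty_of_mem_parts hA
    obtain ⟨G, hG, hiG⟩ := U.exists_mem (W.le hA hi)
    exact ⟨G, hG, W.eq_of_mem_parts (hf G hG) hA (hsub G hG hiG) hi⟩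
  have hinj := Finset.injOn_of_surjOn_of_card_le f hf hsurj hcard.le
  refine le_antisymm (fun A hA => ?_) fun G hG => ⟨f G, hf G hG, hsub G hG⟩
  obtain ⟨G, hG, rfl⟩ := hsurj hA
  refine ⟨G, hG, fun i hi => ?_⟩
  obtain ⟨G', hG', hiG'⟩ := U.exists_mem (W.le hA hi)
  rwa [← hinj hG' hG (W.eq_of_mem_parts (hf G' hG') hA (hsub G' hG' hiG') hi)]

variable {ρ : Measure (ℕ → Fin N → ℝ)} {U : Finpartition (Finset.univ : Finset (Fin N))}

/-- The family may contain sets that are not clusters, such as empty intersections; one index is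
selected for each cluster. -/
theorem clustersIndep_of_iIndep {ι : Type*} {F : ι → Finset (Fin N)}
    (h : iIndep (fun i => seriesSigma (F i)) ρ)
    {W : Finpartition (Finset.univ : Finset (Fin N))} (hW : ∀ D ∈ W.parts, ∃ i, F i = D) :
    ClustersIndep ρ W := by
  choose g hg using fun D : {D // D ∈ W.parts} => hW D.1 D.2
  have hinj : Function.Injective g := fun D D' hDD' =>
    Subtype.ext (by rw [← hg D, ← hg D', hDD'])
  refine (iIndepFun_iff_iIndep _ _ _).2 (iIndep.mono (h.precomp hinj) fun D => ?_)
  simp only [Function.comp, hg]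
  exact le_rfl

theorem ClustersIndep.iIndep (h : ClustersIndep ρ U) :
    iIndep (fun A : {A // A ∈ U.parts} => seriesSigma A.1) ρ :=
  (iIndepFun_iff_iIndep _ _ _).1 h

theorem IsGroundTruth.le_of_iIndep_inf (hU : IsGroundTruth ρ U)
    {V : Finpartition (Finset.univ : Finset (Fin N))} (h : ClustersIndep ρ (U ⊓ V)) : U ≤ V := by
  rcases (inf_le_left : U ⊓ V ≤ U).lt_or_eq with hlt | heq
  · exact absurd h (hU.2 _ hlt)
  · exact inf_eq_left.1 heq

theorem mem_parts_inf {U V : Finpartition (Finset.univ : Finset (Fin N))} {D : Finset (Fin N)}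
    (hD : D ∈ (U ⊓ V).parts) : ∃ A ∈ U.parts, ∃ C ∈ V.parts, A ∩ C = D := by
  rw [Finpartition.parts_inf, Finset.mem_erase, Finset.mem_image] at hD
  obtain ⟨-, p, hp, rfl⟩ := hD
  exact ⟨p.1, (Finset.mem_product.1 hp).1, p.2, (Finset.mem_product.1 hp).2, rfl⟩

/-- The ground truth refines every partition into independent clusters. -/
theorem IsGroundTruth.le_of_clustersIndep [IsProbabilityMeasure ρ] (hU : IsGroundTruth ρ U)
    {V : Finpartition (Finset.univ : Finset (Fin N))} (hV : ClustersIndep ρ V) : U ≤ V := by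
  -- Intersections within one `A` inherit independence from `V`; across different `A` it comes from
  -- `U`.
  have h := iIndep.prod_of_le (m' := fun (A : {A // A ∈ U.parts}) (C : {C // C ∈ V.parts}) =>
      seriesSigma (A.1 ∩ C.1)) hU.1.iIndep
    (fun A C => seriesSigma_mono Finset.inter_subset_left)
    fun A => iIndep.mono hV.iIndep fun C => seriesSigma_mono Finset.inter_subset_right
  refine hU.le_of_iIndep_inf (clustersIndep_of_iIndep h fun D hD => ?_)
  obtain ⟨A, hA, C, hC, rfl⟩ := mem_parts_inf hD
  exact ⟨(⟨A, hA⟩, ⟨C, hC⟩), rfl⟩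

theorem iIndep_bool {Ω : Type*} {mΩ : MeasurableSpace Ω} {μ : Measure Ω} [IsProbabilityMeasure μ]
    {m : Bool → MeasurableSpace Ω} (h : Indep (m true) (m false) μ) : iIndep m μ := by
  refine iIndep_of_forall_iInter fun f hf => ?_
  rw [Fintype.prod_bool, ← (Indep_iff _ _ _).1 h _ _ (hf true) (hf false)]
  congr 1
  ext ω
  simp [and_comm]

/-- A cluster of the ground truth does not decompose into two independent groups. -/
theorem IsGroundTruth.not_indep [IsProbabilityMeasure ρ] (hU : IsGroundTruth ρ U) {G C : Finset (Fin N)}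
    (hG : G ∈ U.parts) (hC : C.Nonempty) (hCG : C ⊂ G) :
    ¬ Indep (seriesSigma C) (seriesSigma (G \ C)) ρ := by
  intro hind
  have hcl : Clink.IsClustering [C, Cᶜ] := by
    obtain ⟨i, -, hi⟩ := Finset.exists_of_ssubset hCG
    refine ⟨?_, ?_, fun j => ?_⟩
    · simpa [hC] using ⟨i, Finset.mem_compl.2 hi⟩
    · simpa using disjoint_compl_right
    · by_cases hj : j ∈ C
      · exact ⟨C, by simp, hj⟩
      · exact ⟨Cᶜ, by simp, Finset.mem_compl.2 hj⟩
  -- Cutting all clusters along `C` and its complement affects only `G`: every other cluster misses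
  -- `C` and contributes a trivial sigma-algebra. Minimality then places `G` on one side of the cut,
  -- which is absurd.
  have h := iIndep.prod_of_le (m' := fun (A : {A // A ∈ U.parts}) (b : Bool) =>
      seriesSigma (A.1 ∩ if b then C else Cᶜ)) hU.1.iIndep
    (fun A b => seriesSigma_mono Finset.inter_subset_left) fun A => iIndep_bool <| by
      by_cases hA : A.1 = G
      · simpa [hA, Finset.inter_eq_right.2 hCG.1, ← Finset.sdiff_eq_inter_compl] using hind
      · have h0 : A.1 ∩ C = ∅ :=
          Finset.disjoint_iff_inter_eq_empty.1 ((U.disjoint A.2 hG hA).mono_right hCG.1)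
        simpa [h0, seriesSigma_empty] using indep_bot_left _
  have hle : U ≤ hcl.toFinpartition := by
    refine hU.le_of_iIndep_inf (clustersIndep_of_iIndep h fun D hD => ?_)
    obtain ⟨A, hA, E, hE, rfl⟩ := mem_parts_inf hD
    have hE' : E = C ∨ E = Cᶜ := by simpa [Clink.IsClustering.toFinpartition] using hE
    rcases hE' with rfl | rfl
    · exact ⟨(⟨A, hA⟩, true), by simp⟩
    · exact ⟨(⟨A, hA⟩, false), by simp⟩
  obtain ⟨E, hE, hGE⟩ := hle hG
  have hE' : E = C ∨ E = Cᶜ := by simpa [Clink.IsClustering.toFinpartition] using hE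
  rcases hE' with rfl | rfl
  · exact hCG.2 hGE
  · obtain ⟨i, hi⟩ := hC
    exact Finset.mem_compl.1 (hGE (hCG.1 hi)) hi

theorem ClustersIndep.indep_compl (hU : ClustersIndep ρ U) {G : Finset (Fin N)}
    (hG : G ∈ U.parts) : Indep (seriesSigma G) (seriesSigma Gᶜ) ρ := by
  have h := indep_iSup_of_disjoint (fun A : {A // A ∈ U.parts} => seriesSigma_le A.1) hU.iIndep
    (S := {⟨G, hG⟩}) (T := {⟨G, hG⟩}ᶜ) disjoint_compl_right
  refine indep_of_indep_of_le_left (indep_of_indep_of_le_right h ?_) ?_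
  · refine Measurable.comap_le (measurable_pi_of_forall fun i => measurable_pi_of_forall fun t => ?_)
    obtain ⟨A, hA, hi⟩ := U.exists_mem (Finset.mem_univ i.1)
    have hne : (⟨A, hA⟩ : {A // A ∈ U.parts}) ∈ ({⟨G, hG⟩}ᶜ : Set {A // A ∈ U.parts}) := by
      intro heq
      obtain rfl : A = G := congrArg Subtype.val heq
      exact Finset.mem_compl.1 i.2 hi
    have hle : seriesSigma A ≤
        ⨆ D ∈ ({⟨G, hG⟩}ᶜ : Set {A // A ∈ U.parts}), seriesSigma D.1 :=
      le_iSup₂ (f := fun (D : {A // A ∈ U.parts}) (_ : D ∈ ({⟨G, hG⟩}ᶜ : Set _)) =>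
        seriesSigma D.1) ⟨A, hA⟩ hne
    exact (measurable_seriesSigma hi t).mono hle le_rfl
  · rw [iSup_singleton]

theorem ClustersIndep.iIndep_get (hU : ClustersIndep ρ U) {V : List (Finset (Fin N))}
    (hV : (V : Multiset (Finset (Fin N))) = U.parts.val) :
    ProbabilityTheory.iIndep (fun j : Fin V.length => seriesSigma (V.get j)) ρ := by
  have hmem A : A ∈ V ↔ A ∈ U.parts := by rw [← Finset.mem_val, ← hV, Multiset.mem_coe]
  have hnd : V.Nodup := by rw [← Multiset.coe_nodup, hV]; exact U.parts.nodup
  exact hU.iIndep.precomp (g := fun j : Fin V.length => ⟨V.get j, (hmem _).1 (List.get_mem _ _)⟩)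
    fun i j hij => List.nodup_iff_injective_get.1 hnd (congrArg Subtype.val hij)

theorem clustersIndep_of_iIndep_get {V : List (Finset (Fin N))} (hV : Clink.IsClustering V)
    (h : ProbabilityTheory.iIndep (fun j : Fin V.length => seriesSigma (V.get j)) ρ) :
    ClustersIndep ρ hV.toFinpartition :=
  clustersIndep_of_iIndep h fun _ hD => List.mem_iff_get.1 (List.mem_toFinset.1 hD)

end GroundTruth

/-! ### Correctness of the algorithm -/

namespace Clink

variable {N : ℕ}

/-- The decrease of `J` caused by the removal of `a` from the second group. -/
def change (J : List (Finset (Fin N)) → ℝ) (C R : Finset (Fin N)) (a : Fin N) : ℝ :=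
  J [C, R] - J [C, R.erase a]

/-- The estimates respect the strict inequalities between values of `J` that the algorithm for `k`
clusters relies on. -/
structure Faithful (J est : List (Finset (Fin N)) → ℝ) (k : ℕ) : Prop where
  change_pos : ∀ C R a, 0 < change J C R a → 0 < change est C R a
  change_lt : ∀ C R a R' b, 0 < change J C R a → change J C R' b ≤ 0 →
    change est C R' b < change est C R a
  lt : ∀ U V, U.length = k → V.length = k → J U < J V → est U < est V

/-- Each strict inequality between limits eventually holds for the estimates. Pairs of groups and
lists of length `k` are finite in number, so a single threshold suffices. -/
theorem eventually_faithful {J : List (Finset (Fin N)) → ℝ} {est : ℕ → List (Finset (Fin N)) → ℝ}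
    (h : ∀ U, Tendsto (fun n => est n U) atTop (𝓝 (J U))) (k : ℕ) :
    ∀ᶠ n in atTop, Faithful J (est n) k := by
  have hc C R a : Tendsto (fun n => change (est n) C R a) atTop (𝓝 (change J C R a)) :=
    (h _).sub (h _)
  have h1 : ∀ᶠ n in atTop, ∀ C R a, 0 < change J C R a → 0 < change (est n) C R a := by
    simp only [eventually_all]
    exact fun C R a hpos => (hc C R a).eventually_const_lt hpos
  have h2 : ∀ᶠ n in atTop, ∀ C R a R' b, 0 < change J C R a → change J C R' b ≤ 0 →
      change (est n) C R' b < change (est n) C R a := by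
    simp only [eventually_all]
    exact fun C R a R' b hpos hle => (hc C R' b).eventually_lt (hc C R a) (hle.trans_lt hpos)
  have h3 : ∀ᶠ n in atTop, ∀ U ∈ {U : List (Finset (Fin N)) | U.length = k},
      ∀ V ∈ {V : List (Finset (Fin N)) | V.length = k}, J U < J V → est n U < est n V := by
    simp only [eventually_all_finite (List.finite_length_eq (Finset (Fin N)) k), eventually_all]
    exact fun U _ V _ hlt => (h U).eventually_lt (h V) hlt
  filter_upwards [h1, h2, h3] with n h1 h2 h3
  exact ⟨h1, h2, fun U V hU hV => h3 U hU V hV⟩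

/-- Second phase of the scan: the record `d` already beats the estimated change of every removal
without true effect, so only removals with a positive effect, hence of members of `G`, can replace
`xmax`. -/
theorem output_maxChange_mem_of_mem {J est : List (Finset (Fin N)) → ℝ} {k : ℕ}
    (hF : Faithful J est k) {C G : Finset (Fin N)} (hG : ∀ R a, 0 < change J C R a → a ∈ G)
    (L : List (Fin N)) (R : Finset (Fin N)) (d : ℝ) (x : Fin N)
    (hx : x ∈ G) (hd : ∀ R b, change J C R b ≤ 0 → change est C R b < d) :
    (maxChange C L R d x).output est ∈ G := by
  induction L generalizing R d x with
  | nil => exact hx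
  | cons a L ih =>
    simp only [maxChange, QueryProg.output_ask]
    split_ifs with h
    · rcases lt_or_ge 0 (change J C R a) with hpos | hle
      · exact ih _ _ _ (hG R a hpos) fun R' b hb => hF.change_lt C R a R' b hpos hb
      · exact absurd h (hd R a hle).not_gt
    · exact ih _ _ _ hx hd

/-- First phase of the scan: the record is still below the estimate of every truly positive change.
Removals are without replacement, so their true changes telescope to the total drop `hJ`, and some
positive one must occur; it sets the record and starts the second phase. -/
theorem output_maxChange_mem_of_lt {J est : List (Finset (Fin N)) → ℝ} {k : ℕ}
    (hF : Faithful J est k) {C G : Finset (Fin N)} (hG : ∀ R a, 0 < change J C R a → a ∈ G)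
    (L : List (Fin N)) (R : Finset (Fin N)) (d : ℝ) (x : Fin N)
    (hd : ∀ R a, 0 < change J C R a → d < change est C R a)
    (hJ : J [C, L.foldl Finset.erase R] < J [C, R]) :
    (maxChange C L R d x).output est ∈ G := by
  induction L generalizing R d x with
  | nil => exact absurd hJ (lt_irrefl _)
  | cons a L ih =>
    simp only [maxChange, QueryProg.output_ask]
    rw [List.foldl_cons] at hJ
    rcases lt_or_ge 0 (change J C R a) with hpos | hle
    · rw [if_pos (show d < est [C, R] - est [C, R.erase a] from hd R a hpos)]
      exact output_maxChange_mem_of_mem hF hG L _ _ _ (hG R a hpos) fun R' b hb =>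
        hF.change_lt C R a R' b hpos hb
    -- A removal without positive effect does not lower `J`, so the drop is still to come, even if
    -- this removal sets the record.
    · have hJ' := hJ.trans_le (sub_nonpos.1 hle)
      split_ifs
      · exact ih _ _ _ (fun R' b hb => hF.change_lt C R' b R a hb hle) hJ'
      · exact ih _ _ _ hd hJ'

theorem mem_foldl_erase {L : List (Fin N)} {R : Finset (Fin N)} {i : Fin N} :
    i ∈ L.foldl Finset.erase R ↔ i ∈ R ∧ i ∉ L := by
  induction L generalizing R with
  | nil => simp
  | cons a L ih => simp [ih, and_assoc, and_left_comm]

section GroundTruth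

variable {ρ : Measure (ℕ → Fin N → ℝ)} [IsProbabilityMeasure ρ] {B : QuantizerFamily}
  {U : Finpartition (Finset.univ : Finset (Fin N))} {est : List (Finset (Fin N)) → ℝ} {k : ℕ}

theorem moved_mem_groundTruth (hρ : IsStationaryErgodic ρ) (hU : IsGroundTruth ρ U)
    (hF : Faithful (sumInfo B ρ) est k) (ord : ScanOrder N) {S C G : Finset (Fin N)} (a : Fin N)
    (hG : G ∈ U.parts) (hGS : G ⊆ S) (hC : C.Nonempty) (hCG : C ⊂ G) :
    moved ord est S C a ∈ G := by
  refine output_maxChange_mem_of_lt hF (fun R b hpos => ?_) _ _ _ _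
    (fun R b hpos => hF.change_pos C R b hpos) ?_
  · by_contra hb
    have hind := hU.1.indep_compl hG
    have h1 : R.erase b ∩ G = R ∩ G := by
      rw [Finset.erase_inter, Finset.erase_eq_of_notMem fun h => hb (Finset.mem_inter.1 h).2]
    rw [change, sumInfo_pair_inter B hCG.1 hind R, sumInfo_pair_inter B hCG.1 hind (R.erase b), h1,
      sub_self] at hpos
    exact lt_irrefl _ hpos
  · have h0 : (ord.list (S \ C)).foldl Finset.erase (S \ C) = ∅ :=
      Finset.eq_empty_of_forall_notMem fun i hi =>
        (mem_foldl_erase.1 hi).2 ((ord.mem_list _ _).2 (mem_foldl_erase.1 hi).1)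
    rw [h0, sumInfo_pair_empty]
    refine (sumInfo_nonneg B ρ _).lt_of_ne' fun hzero => hU.not_indep hG hC hCG ?_
    exact indep_of_indep_of_le_right (hρ.indep_of_sumInfo_pair_eq_zero B hzero)
      (seriesSigma_mono (Finset.sdiff_subset_sdiff hGS subset_rfl))

/-- As long as `C` is a proper part of `G` only members of `G` are added, so `C` equals `G` at some
iteration. The remainder is nonempty then, because `G ≠ S`, and the split is recorded. -/
theorem mem_output_splitLoop_groundTruth (hρ : IsStationaryErgodic ρ) (hU : IsGroundTruth ρ U)
    (hF : Faithful (sumInfo B ρ) est k) (ord : ScanOrder N) {S G : Finset (Fin N)}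
    (hG : G ∈ U.parts) (hGS : G ⊂ S) {fuel : ℕ} {C : Finset (Fin N)} (hC : C.Nonempty)
    (hCG : C ⊆ G) (hfuel : (S \ C).card ≤ fuel) :
    (G, S \ G) ∈ (splitLoop ord S fuel C).output est := by
  have hne : (S \ C).Nonempty := Finset.sdiff_nonempty.2 fun h => hGS.2 (h.trans hCG)
  induction fuel generalizing C with
  | zero => exact absurd (Finset.card_pos.2 hne) (by omega)
  | succ fuel ih =>
    obtain ⟨i, hi⟩ := hne
    rcases hL : ord.list (S \ C) with _ | ⟨a, L⟩
    · rw [← ord.mem_list, hL] at hi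
      exact absurd hi List.not_mem_nil
    rw [output_splitLoop_succ hL, List.mem_cons]
    rcases hCG.eq_or_ssubset with rfl | hss
    · exact Or.inl rfl
    · have hm := moved_mem_groundTruth hρ hU hF ord a hG hGS.1 hC hss
      have hcard := card_sdiff_insert_add_one (moved_mem hL est)
      have hsub := Finset.insert_subset hm hCG
      exact Or.inr (ih (Finset.insert_nonempty _ _) hsub (by omega)
        (Finset.sdiff_nonempty.2 fun h => hGS.2 (h.trans hsub)))

/-- Here `hunion` says that `S` is a union of ground-truth clusters; the one containing the first
element of `S` is split off. -/
theorem exists_mem_output_split (hρ : IsStationaryErgodic ρ) (hU : IsGroundTruth ρ U)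
    (hF : Faithful (sumInfo B ρ) est k) (ord : ScanOrder N) {S : Finset (Fin N)}
    (hS : S.Nonempty) (hS' : S ∉ U.parts) (hunion : ∀ G ∈ U.parts, ∀ i ∈ G, i ∈ S → G ⊆ S) :
    ∃ G ∈ U.parts, (G, S \ G) ∈ (split ord S).output est := by
  rcases hL : ord.list S with _ | ⟨a, L⟩
  · obtain ⟨i, hi⟩ := hS
    rw [← ord.mem_list, hL] at hi
    exact absurd hi List.not_mem_nil
  · have ha : a ∈ S := by rw [← ord.mem_list, hL]; exact List.mem_cons_self
    obtain ⟨G, hG, haG⟩ := U.exists_mem (Finset.mem_univ a)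
    have hGS := (hunion G hG a haG ha).ssubset_of_ne fun h => hS' (h ▸ hG)
    refine ⟨G, hG, ?_⟩
    simp only [split, hL]
    exact mem_output_splitLoop_groundTruth hρ hU hF ord hG hGS (Finset.singleton_nonempty a)
      (Finset.singleton_subset_iff.2 haG) (Finset.card_le_card Finset.sdiff_subset)

theorem IsClustering.card_parts_toFinpartition {V : List (Finset (Fin N))} (h : IsClustering V) :
    h.toFinpartition.parts.card = V.length :=
  List.toFinset_card_of_nodup h.nodup

/-- A clustering coarser than `U` with fewer clusters has a cluster that is not in `U`. It is a
union of several clusters of `U`, and splitting off one of them keeps the clustering coarser than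
`U`. -/
theorem exists_mem_candidates_coarser [NeZero N] (hρ : IsStationaryErgodic ρ)
    (hU : IsGroundTruth ρ U) (hF : Faithful (sumInfo B ρ) est k) (ord : ScanOrder N) {j : ℕ}
    (hj : j + 1 ≤ U.parts.card) :
    ∃ V ∈ (candidates ord j).output est, ∀ G ∈ U.parts, ∃ A ∈ V, G ⊆ A := by
  induction j with
  | zero => exact ⟨[Finset.univ], by simp [candidates], by simp⟩
  | succ j ih =>
    obtain ⟨V, hV, hUV⟩ := ih (by omega)
    obtain ⟨hcl, hlen⟩ := isClustering_of_mem_candidates hV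
    have hA : ∃ A ∈ V, A ∉ U.parts := by
      by_contra! hall
      have h1 : U ≤ hcl.toFinpartition := fun G hG => by
        obtain ⟨A, hA, hGA⟩ := hUV G hG
        exact ⟨A, List.mem_toFinset.2 hA, hGA⟩
      have h2 : hcl.toFinpartition ≤ U := fun A hA =>
        ⟨A, hall A (List.mem_toFinset.1 hA), le_rfl⟩
      have h3 := hcl.card_parts_toFinpartition
      rw [← le_antisymm h1 h2] at h3
      omega
    obtain ⟨A, hA, hAU⟩ := hA
    have hunion : ∀ G ∈ U.parts, ∀ i ∈ G, i ∈ A → G ⊆ A := by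
      intro G hG i hiG hiA
      obtain ⟨A', hA', hGA'⟩ := hUV G hG
      by_cases hAA : A = A'
      · rwa [hAA]
      · exact absurd (hGA' hiG) (Finset.disjoint_left.1 (hcl.disjoint_of_ne hA hA' hAA) hiA)
    obtain ⟨G, hG, hsplit⟩ := exists_mem_output_split hρ hU hF ord (hcl.nonempty A hA) hAU hunion
    obtain ⟨l₁, l₂, rfl⟩ := List.append_of_mem hA
    refine ⟨l₁ ++ G :: (A \ G) :: l₂, mem_output_candidates_succ.2
      ⟨_, hV, mem_output_refineOne.2 ⟨l₁, A, l₂, G, A \ G, rfl, hsplit, by simp⟩⟩,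
      fun G' hG' => ?_⟩
    obtain ⟨A', hA', hGA'⟩ := hUV G' hG'
    simp only [List.mem_append, List.mem_cons] at hA' ⊢
    rcases hA' with h | rfl | h
    · exact ⟨A', Or.inl h, hGA'⟩
    · by_cases hGG : G' = G
      · exact ⟨G, by tauto, hGG.le⟩
      · exact ⟨A' \ G, by tauto, Finset.subset_sdiff.2 ⟨hGA', U.disjoint hG' hG hGG⟩⟩
    · exact ⟨A', by tauto, hGA'⟩

theorem IsClustering.coe_eq_of_le {V : List (Finset (Fin N))} (h : IsClustering V)
    (hle : U ≤ h.toFinpartition) (hcard : U.parts.card = V.length) :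
    (V : Multiset (Finset (Fin N))) = U.parts.val := by
  rw [← h.val_parts_toFinpartition,
    Finpartition.eq_of_le_of_card_eq hle (hcard.trans h.card_parts_toFinpartition.symm)]

theorem output_clink_of_faithful (hρ : IsStationaryErgodic ρ) (hU : IsGroundTruth ρ U)
    (hk : 1 ≤ k) (hcard : U.parts.card = k) (hF : Faithful (sumInfo B ρ) est k)
    (ord : ScanOrder N) :
    (((clink ord k).output est : List (Finset (Fin N))) : Multiset (Finset (Fin N))) =
      U.parts.val := by
  have : NeZero N := ⟨by
    rintro rfl
    have : U.parts.card ≤ 0 := U.card_parts_le_card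
    omega⟩
  obtain ⟨V, hV, hUV⟩ := exists_mem_candidates_coarser hρ hU hF ord (j := k - 1) (by omega)
  obtain ⟨hVcl, hVlen⟩ := isClustering_of_mem_candidates hV
  have hVU : (V : Multiset (Finset (Fin N))) = U.parts.val :=
    hVcl.coe_eq_of_le (fun G hG => by
      obtain ⟨A, hA, hGA⟩ := hUV G hG
      exact ⟨A, List.mem_toFinset.2 hA, hGA⟩) (by omega)
  have hV0 : sumInfo B ρ V = 0 := (hρ.sumInfo_eq_zero_iff B V).2 (hU.1.iIndep_get hVU)
  obtain ⟨hmem, hmin⟩ := output_selectMin est (List.ne_nil_of_mem hV)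
  rw [clink, QueryProg.output_bind]
  obtain ⟨hWcl, hWlen⟩ := isClustering_of_mem_candidates hmem
  -- Were the limit positive at the selected clustering, its estimate would exceed that of `V`,
  -- whose limit is `0`, contrary to minimality.
  have hW0 : sumInfo B ρ ((selectMin ((candidates ord (k - 1)).output est)).output est) = 0 := by
    by_contra hne
    refine (hmin V hV).not_gt (hF.lt _ _ (by omega) (by omega) ?_)
    rw [hV0]
    exact (sumInfo_nonneg B ρ _).lt_of_ne' hne
  exact hWcl.coe_eq_of_le (hU.le_of_clustersIndep
    (clustersIndep_of_iIndep_get hWcl ((hρ.sumInfo_eq_zero_iff B _).1 hW0))) (by omega)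

end GroundTruth

end Clink

theorem mainTheorem1 (N k : ℕ) (hk : 1 ≤ k) (ord : ScanOrder N) :
    (∀ (B : QuantizerFamily) (ρ : Measure (ℕ → Fin N → ℝ)) [IsProbabilityMeasure ρ],
      IsStationaryErgodic ρ →
      ∀ U : Finpartition (Finset.univ : Finset (Fin N)), IsGroundTruth ρ U → U.parts.card = k →
        ∀ᵐ x ∂ρ, ∀ᶠ n : ℕ in atTop,
          (((clink ord k).output (empSumInfo B n x) : List (Finset (Fin N))) :
            Multiset (Finset (Fin N))) = U.parts.val) ∧
    (∀ est : List (Finset (Fin N)) → ℝ, (clink ord k).calls est ≤ N ^ (2 * k - 2)) := by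
  refine ⟨fun B ρ _ hρ U hU hcard => ?_, calls_clink_le ord hk⟩
  filter_upwards [hρ.tendsto_empSumInfo B] with x hx
  filter_upwards [Clink.eventually_faithful hx k] with n hn
  exact Clink.output_clink_of_faithful hρ hU hk hcard hn ord
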